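/- Let $\mathbf k$ be a commutative $\mathbb Q$-algebra. Graded means $\mathbb Z_{\ge0}$-graded. **Graded modules.** For a graded $\mathbf k$-algebra $A$ let $\mathrm{GrMod}(A)$ be the category of graded left $A$-modules with $A$-linear maps of degree $0$, and $\mathrm{GrMod}_{\mathrm{fin}}(A)$ the full subcategory of the modules with only finitely many nonzero components. A morphism of graded algebras $f:A\to B$ induces by restriction of scalars $f^*:\mathrm{GrMod}(B)\to\mathrm{GrMod}(A)$, and likewise on the categories $\mathrm{GrMod}_{\mathrm{fin}}$. The algebra $\mathbf k$ is graded by placing it in degree $0$. **$U(\mathfrak f_2)$, $\mathcal W_l^{\mathrm{DR}}$, $\mathcal W_r^{\mathrm{DR}}$ and $\Delta_\star^{l,r}$.** Let $\mathfrak f_2$ be the free Lie $\mathbf k$-algebra on $e_0,e_1$ (degree $1$); put $x_0=e_0$, $x_1=-e_1$, $e_\infty=-e_0-e_1$. Let $\mathcal W_l^{\mathrm{DR}}=\mathbf k1\oplus U(\mathfrak f_2)e_1$ and $\mathcal W_r^{\mathrm{DR}}=\mathbf k1\oplus e_1U(\mathfrak f_2)$, graded subalgebras of $U(\mathfrak f_2)$;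 let $\mathrm{inc}:\mathcal W_r^{\mathrm{DR}}\hookrightarrow U(\mathfrak f_2)$ be the inclusion, and $\mathrm{Ad}(e_1):\mathcal W_l^{\mathrm{DR}}\to\mathcal W_r^{\mathrm{DR}}$ the algebra isomorphism with $1\mapsto1$, $ae_1\mapsto e_1a$. The algebra $\mathcal W_l^{\mathrm{DR}}$ is freely generated by the elements $y_n=x_0^{n-1}x_1$, $n\ge1$; let $\Delta_\star:\mathcal W_l^{\mathrm{DR}}\to(\mathcal W_l^{\mathrm{DR}})^{\otimes2}$ be the algebra morphism with $$\Delta_\star(y_n)=y_n\otimes1+1\otimes y_n+\sum_{n'+n''=n;\ n',n''>0}y_{n'}\otimes y_{n''},$$ and $\Delta_\star^{l,r}:=\mathrm{Ad}(e_1)^{\otimes2}\circ\Delta_\star:\mathcal W_l^{\mathrm{DR}}\to(\mathcal W_r^{\mathrm{DR}})^{\otimes2}$, a morphism of graded algebras. **Infinitesimal braid Lie algebras.** For $n\in\{4,5\}$ let $\mathfrak p_n$ be the graded Lie $\mathbf k$-algebra with generators $e_{ij}$, $i\ne j\in\{1,\dots,n\}$, of degree $1$ and relations $e_{ji}=e_{ij}$,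 $\sum_{j\ne i}e_{ij}=0$, and $[e_{ij},e_{kl}]=0$ for $i,j,k,l$ distinct. Identify $\mathfrak p_4\simeq\mathfrak f_2$ by $e_{14}=e_{23}=e_0$, $e_{12}=e_{34}=e_1$, $e_{13}=e_{24}=e_\infty$. Let $\mathrm{pr}_1,\mathrm{pr}_2,\mathrm{pr}_5:\mathfrak p_5\to\mathfrak p_4$ be the Lie algebra morphisms sending $(e_{12},e_{13},e_{14},e_{15},e_{23},e_{24},e_{25},e_{34},e_{35},e_{45})$ respectively to $$(0,0,0,0,e_0,e_\infty,e_1,e_1,e_\infty,e_0),\quad(0,e_\infty,e_0,e_1,0,0,0,e_1,e_0,e_\infty),\quad(e_1,e_\infty,e_0,0,e_0,e_\infty,0,e_1,0,0).$$ Let $\mathrm{pr}_{12}:U(\mathfrak p_5)\to U(\mathfrak f_2)^{\otimes2}$ be the algebra morphism with $x\mapsto\mathrm{pr}_1(x)\otimes1+1\otimes\mathrm{pr}_2(x)$ for $x\in\mathfrak p_5$, let $\ell:U(\mathfrak f_2)\to U(\mathfrak p_5)$ be the algebra morphism with $e_0\mapsto e_{23}$, $e_1\mapsto e_{12}$, and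 let $J(\mathrm{pr}_5)$ be the two-sided ideal $\mathrm{Ker}(\mathrm{pr}_5:U(\mathfrak p_5)\to U(\mathfrak p_4))$; it is a free left $U(\mathfrak p_5)$-module with basis $e_{15},e_{25},e_{35}$. For $N$ in $\mathrm{GrMod}(U(\mathfrak p_5))$ let $F_{J(\mathrm{pr}_5)}(N)$ be the module of all $U(\mathfrak p_5)$-linear maps $\varphi:J(\mathrm{pr}_5)\to N$, with $(a\varphi)(b)=\varphi(ba)$, and with the grading for which $\varphi\mapsto(\varphi(e_{15}),\varphi(e_{25}),\varphi(e_{35}))$ is an isomorphism of graded $\mathbf k$-modules onto $N^{\oplus3}$. This defines an endofunctor of $\mathrm{GrMod}(U(\mathfrak p_5))$. **Quadruples.** Let $\mathrm{Quad}^{\mathrm{DR}}$ be the category of quadruples $(V,W,\alpha,\beta)$ with $V$ in $\mathrm{GrMod}(U(\mathfrak f_2))$, $W$ in $\mathrm{GrMod}(\mathbf k)$, and $\alpha:V\to W$, $\beta:W\to V$ $\mathbf k$-linear of degrees $1$ and $0$ such that $\beta\circ\alpha$ is the action of $e_1$ on $V$; morphisms are the pairs of a morphism in $\mathrm{GrMod}(U(\mathfrak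 f_2))$ and one in $\mathrm{GrMod}(\mathbf k)$ that commute with the maps $\alpha,\beta$. Let $\mathrm{Quad}^{\mathrm{DR}}_{\mathrm{fin}}$ be the full subcategory where $V$ and $W$ have finitely many nonzero components. * $F_{QW}^{\mathrm{DR}}:\mathrm{Quad}^{\mathrm{DR}}\to\mathrm{GrMod}(\mathcal W_l^{\mathrm{DR}})$ sends $(V,W,\alpha,\beta)$ to $W$, on which $1$ acts as the identity and $xe_1$ as $\alpha\circ x_{|V}\circ\beta$ ($x\in U(\mathfrak f_2)$). * $F_{VQ}^{\mathrm{DR}}:\mathrm{GrMod}(U(\mathfrak f_2)^{\otimes2})\to\mathrm{Quad}^{\mathrm{DR}}$ sends $C$ to $(V(C),W(C),\alpha(C),\beta(C))$, where $V(C)=\ell^*\circ F_{J(\mathrm{pr}_5)}\circ\mathrm{pr}_{12}^*(C)$, $W(C)$ is $C$ as a graded $\mathbf k$-module, $\alpha(C)(\varphi)=(e_1\otimes1)\varphi(e_{15})-(1\otimes e_1)\varphi(e_{25})$, and $\beta(C)(c)$ is the unique $\varphi_c$ with $\varphi_c(e_{15})=c$, $\varphi_c(e_{25})=-c$, $\varphi_c(e_{35})=0$.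 Both functors restrict to functors between the finite-support subcategories. **Proposition.** There is a natural equivalence $$\eta^{\mathrm{DR}}:\ (\Delta_\star^{l,r})^*\circ(\mathrm{inc}^{\otimes2})^*\ \Longrightarrow\ F_{QW}^{\mathrm{DR}}\circ F_{VQ}^{\mathrm{DR}}$$ between functors $\mathrm{GrMod}(U(\mathfrak f_2)^{\otimes2})\to\mathrm{GrMod}(\mathcal W_l^{\mathrm{DR}})$, and it restricts to a natural equivalence between the corresponding composite functors $\mathrm{GrMod}_{\mathrm{fin}}(U(\mathfrak f_2)^{\otimes2})\to\mathrm{GrMod}_{\mathrm{fin}}(\mathcal W_l^{\mathrm{DR}})$ through $\mathrm{GrMod}_{\mathrm{fin}}((\mathcal W_r^{\mathrm{DR}})^{\otimes2})$ and through $\mathrm{Quad}^{\mathrm{DR}}_{\mathrm{fin}}$. -/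

import Mathlib

set_option linter.unusedSectionVars false
set_option linter.unusedSimpArgs false
set_option linter.unnecessarySeqFocus false
set_option linter.unusedVariables false

open CategoryTheory TensorProduct

universe u v v' w

noncomputable section

namespace DeRham

/-! ### Graded modules over graded algebras -/

section GradedModules

variable {k : Type u} [CommRing k]
variable {A : Type v} [Ring A] [Algebra k A]
variable {B : Type v'} [Ring B] [Algebra k B]

/-- A `ℕ`-graded left module over the `k`-algebra `A` whose component of degree `n` is `𝒜 n`:
a `k`-module with a `k`-linear left action of `A` and a direct sum decomposition
`⨁ n, deg n` such that `𝒜 i • deg j ⊆ deg (i + j)`. -/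
structure GrMod (𝒜 : ℕ → Submodule k A) where
  carrier : Type w
  [addCommGroup : AddCommGroup carrier]
  [module : Module k carrier]
  act : A →ₐ[k] Module.End k carrier
  deg : ℕ → Submodule k carrier
  isInternal : DirectSum.IsInternal deg
  act_mem : ∀ {i j : ℕ} {a : A} {m : carrier}, a ∈ 𝒜 i → m ∈ deg j → act a m ∈ deg (i + j)

attribute [instance] GrMod.addCommGroup GrMod.module

namespace GrMod

/-- Morphisms of graded modules: `A`-linear maps of degree `0`. -/
@[ext]
structure Hom {𝒜 : ℕ → Submodule k A} (M N : GrMod.{u, v, w} 𝒜) where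
  toLin : M.carrier →ₗ[k] N.carrier
  map_act : ∀ (a : A) (m : M.carrier), toLin (M.act a m) = N.act a (toLin m)
  map_deg : ∀ {n : ℕ} {m : M.carrier}, m ∈ M.deg n → toLin m ∈ N.deg n

instance category (𝒜 : ℕ → Submodule k A) : Category (GrMod.{u, v, w} 𝒜) where
  Hom M N := Hom M N
  id M := ⟨LinearMap.id, fun _ _ => rfl, fun h => h⟩
  comp f g := ⟨g.toLin ∘ₗ f.toLin, fun a m => by simp [f.map_act, g.map_act],
    fun h => g.map_deg (f.map_deg h)⟩

/-- The finite support property: only finitely many components are nonzero. -/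
def IsFin (𝒜 : ℕ → Submodule k A) : ObjectProperty (GrMod.{u, v, w} 𝒜) :=
  fun M => {n : ℕ | M.deg n ≠ ⊥}.Finite

/-- The module obtained by restriction of scalars along a morphism of graded algebras. -/
abbrev pullObj {𝒜 : ℕ → Submodule k A} {ℬ : ℕ → Submodule k B} (f : A →ₐ[k] B)
    (hf : ∀ (n : ℕ) (a : A), a ∈ 𝒜 n → f a ∈ ℬ n) (M : GrMod.{u, v', w} ℬ) :
    GrMod.{u, v, w} 𝒜 where
  carrier := M.carrier
  act := M.act.comp f
  deg := M.deg
  isInternal := M.isInternal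
  act_mem := fun ha hm => M.act_mem (hf _ _ ha) hm

/-- Restriction of scalars along a morphism of graded algebras. -/
def pullback {𝒜 : ℕ → Submodule k A} {ℬ : ℕ → Submodule k B} (f : A →ₐ[k] B)
    (hf : ∀ (n : ℕ) (a : A), a ∈ 𝒜 n → f a ∈ ℬ n) :
    GrMod.{u, v', w} ℬ ⥤ GrMod.{u, v, w} 𝒜 where
  obj M := pullObj f hf M
  map φ := ⟨φ.toLin, fun a m => φ.map_act (f a) m, fun h => φ.map_deg h⟩

end GrMod

/-- The full subcategory of graded modules with finite support. -/
abbrev GrModFin (𝒜 : ℕ → Submodule k A) := (GrMod.IsFin.{u, v, w} 𝒜).FullSubcategory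

/-- The functor between full subcategories induced by a functor preserving the properties. -/
def restrict {C : Type*} [Category C] {D : Type*} [Category D] (F : C ⥤ D)
    (P : ObjectProperty C) (Q : ObjectProperty D) (h : ∀ X : C, P X → Q (F.obj X)) :
    P.FullSubcategory ⥤ Q.FullSubcategory :=
  Q.lift (P.ι ⋙ F) (fun X => h X.obj X.property)

/-- The base ring, concentrated in degree `0`. -/
def baseDeg (k : Type u) [CommRing k] (n : ℕ) : Submodule k k := if n = 0 then ⊤ else ⊥

/-- The total grading of a tensor product of two graded modules. -/
def tensorDeg (𝒜 : ℕ → Submodule k A) (ℬ : ℕ → Submodule k B) (n : ℕ) : Submodule k (A ⊗[k] B) :=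
  ⨆ (i : ℕ) (j : ℕ) (_ : i + j = n), Submodule.map₂ (TensorProduct.mk k A B) (𝒜 i) (ℬ j)

end GradedModules


/-! ### Sphere infinitesimal braid Lie algebras -/

attribute [local instance 100] LieRing.ofAssociativeRing

section LieAlgebras

variable (k : Type u) [CommRing k]

/-- Defining relations of the sphere infinitesimal braid Lie algebra; index `i : Fin n` stands for
the strand number `i + 1`. -/
structure SphereBraidRel {n : ℕ} {L : Type v} [LieRing L] (f : Fin n → Fin n → L) : Prop where
  diag : ∀ i, f i i = 0
  symm : ∀ i j, f j i = f i j
  sum : ∀ i, ∑ j, f i j = 0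
  comm : ∀ i j l m, i ≠ j → i ≠ l → i ≠ m → j ≠ l → j ≠ m → l ≠ m → ⁅f i j, f l m⁆ = 0

/-- The relators of `𝔭_n` in the free Lie algebra on symbols `e_{ij}` (with `e_{ii} = 0`). -/
inductive IsRelator (n : ℕ) : FreeLieAlgebra k (Fin n × Fin n) → Prop
  | diag (i : Fin n) : IsRelator n (FreeLieAlgebra.of k (i, i))
  | symm (i j : Fin n) :
      IsRelator n (FreeLieAlgebra.of k (j, i) - FreeLieAlgebra.of k (i, j))
  | sum (i : Fin n) : IsRelator n (∑ j, FreeLieAlgebra.of k (i, j))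
  | comm (i j l m : Fin n) (h₁ : i ≠ j) (h₂ : i ≠ l) (h₃ : i ≠ m) (h₄ : j ≠ l) (h₅ : j ≠ m)
      (h₆ : l ≠ m) :
      IsRelator n ⁅(FreeLieAlgebra.of k (i, j) : FreeLieAlgebra k (Fin n × Fin n)),
        FreeLieAlgebra.of k (l, m)⁆

/-- The Lie ideal generated by the relators. -/
def relIdeal (n : ℕ) : LieIdeal k (FreeLieAlgebra k (Fin n × Fin n)) :=
  LieSubmodule.lieSpan k _ {z | IsRelator k n z}

/-- The sphere infinitesimal braid Lie algebra `𝔭_n`. -/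
abbrev SphereBraid (n : ℕ) : Type u := FreeLieAlgebra k (Fin n × Fin n) ⧸ relIdeal k n

/-- The generator `e_{i+1,j+1}` of `𝔭_n`. -/
def E {n : ℕ} (i j : Fin n) : SphereBraid k n :=
  LieSubmodule.Quotient.mk (FreeLieAlgebra.of k (i, j))

variable {k}

theorem mk_eq_zero_of_isRelator {n : ℕ} {z : FreeLieAlgebra k (Fin n × Fin n)}
    (h : IsRelator k n z) : (LieSubmodule.Quotient.mk z : SphereBraid k n) = 0 :=
  LieSubmodule.Quotient.mk_eq_zero'.2 (LieSubmodule.subset_lieSpan h)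

theorem sphereBraidRel_E (n : ℕ) : SphereBraidRel (E k (n := n)) where
  diag i := mk_eq_zero_of_isRelator (.diag i)
  symm i j := by
    have h := mk_eq_zero_of_isRelator (.symm (k := k) i j)
    exact sub_eq_zero.1 h
  sum i := by
    have h := mk_eq_zero_of_isRelator (.sum (k := k) i)
    have h2 : (LieSubmodule.Quotient.mk' (relIdeal k n))
      (∑ j, FreeLieAlgebra.of k (i, j)) = 0 := h
    rw [map_sum] at h2
    exact h2
  comm i j l m h₁ h₂ h₃ h₄ h₅ h₆ := by
    have h := mk_eq_zero_of_isRelator (.comm (k := k) i j l m h₁ h₂ h₃ h₄ h₅ h₆)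
    exact h

/-- The Lie algebra morphism out of `𝔭_n` defined by images of the generators. -/
def SphereBraid.lift {n : ℕ} {L : Type v} [LieRing L] [LieAlgebra k L] (f : Fin n → Fin n → L)
    (hf : SphereBraidRel f) : SphereBraid k n →ₗ⁅k⁆ L :=
  let F : FreeLieAlgebra k (Fin n × Fin n) →ₗ⁅k⁆ L := FreeLieAlgebra.lift k fun p => f p.1 p.2
  have hF : relIdeal k n ≤ F.ker := by
    refine LieSubmodule.lieSpan_le.2 ?_
    intro z hz
    change F z = 0
    cases hz with
    | diag i => simp [F, hf.diag]
    | symm i j => simp [F, hf.symm i j]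
    | sum i => simp [F, map_sum, hf.sum]
    | comm i j l m h₁ h₂ h₃ h₄ h₅ h₆ => simp [F, hf.comm i j l m h₁ h₂ h₃ h₄ h₅ h₆]
  { Submodule.liftQ (relIdeal k n).toSubmodule (F : FreeLieAlgebra k (Fin n × Fin n) →ₗ[k] L)
      (fun z hz => LinearMap.mem_ker.2 (LieHom.mem_ker.1 (hF hz))) with
    map_lie' := by
      intro x y
      induction x using Submodule.Quotient.induction_on with | _ x =>
      induction y using Submodule.Quotient.induction_on with | _ y =>
      exact F.map_lie x y }

@[simp]
theorem SphereBraid.lift_E {n : ℕ} {L : Type v} [LieRing L] [LieAlgebra k L]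
    (f : Fin n → Fin n → L) (hf : SphereBraidRel f) (i j : Fin n) :
    SphereBraid.lift (k := k) f hf (E k i j) = f i j :=
  FreeLieAlgebra.lift_of_apply (R := k) (fun p : Fin n × Fin n => f p.1 p.2) (i, j)

theorem SphereBraid.hom_ext {n : ℕ} {L : Type v} [LieRing L] [LieAlgebra k L]
    {F G : SphereBraid k n →ₗ⁅k⁆ L} (h : ∀ i j, F (E k i j) = G (E k i j)) : F = G := by
  let π : FreeLieAlgebra k (Fin n × Fin n) →ₗ⁅k⁆ SphereBraid k n :=
    { (LieSubmodule.Quotient.mk' (relIdeal k n) : _ →ₗ[k] _) with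
      map_lie' := fun {x y} => LieSubmodule.Quotient.mk_bracket _ x y }
  have h2 : F.comp π = G.comp π := FreeLieAlgebra.hom_ext fun p => h p.1 p.2
  ext x
  induction x using Submodule.Quotient.induction_on with | _ x =>
  exact DFunLike.congr_fun h2 x

end LieAlgebras


section FiveStrands

/-- The ten elements attached to five elements of an additive group, standing for
`e_12, e_23, e_15, e_25, e_35`. -/
def fiveTable {L : Type v} [AddCommGroup L] (a b x y z : L) : Fin 5 → Fin 5 → L :=
  !![0, a, -(x + y + z) - a - b, b + y + z, x;
     a, 0, b, -y - a - b, y;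
     -(x + y + z) - a - b, b, 0, a + x + y, z;
     b + y + z, -y - a - b, a + x + y, 0, -(x + y + z);
     x, y, z, -(x + y + z), 0]

theorem sphereBraidRel_fiveTable {L : Type v} [LieRing L] (a b x y z : L)
    (h₁ : ⁅a, z⁆ = 0) (h₂ : ⁅b, x⁆ = 0) (h₃ : ⁅a, x⁆ + ⁅a, y⁆ = 0) (h₄ : ⁅b, y⁆ + ⁅b, z⁆ = 0)
    (h₅ : ⁅b, y⁆ = ⁅y, z⁆) (h₆ : ⁅a, y⁆ = ⁅y, x⁆) :
    SphereBraidRel (fiveTable a b x y z) where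
  diag i := by fin_cases i <;> rfl
  symm i j := by fin_cases i <;> fin_cases j <;> rfl
  sum i := by fin_cases i <;> simp [fiveTable, Fin.sum_univ_five] <;> abel
  comm := by
    have k₁ : ⁅z, a⁆ = 0 := by rw [← lie_skew, h₁, neg_zero]
    have k₂ : ⁅x, b⁆ = 0 := by rw [← lie_skew, h₂, neg_zero]
    have s₁ : ⁅z, y⁆ = -⁅y, z⁆ := (lie_skew _ _).symm
    have s₂ : ⁅x, y⁆ = -⁅y, x⁆ := (lie_skew _ _).symm
    have s₃ : ⁅z, x⁆ = -⁅x, z⁆ := (lie_skew _ _).symm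
    have s₄ : ⁅b, a⁆ = -⁅a, b⁆ := (lie_skew _ _).symm
    have h₃' : ⁅a, x⁆ = -⁅y, x⁆ := by rw [← h₆]; exact eq_neg_of_add_eq_zero_left h₃
    have h₄' : ⁅b, z⁆ = -⁅y, z⁆ := by rw [← h₅]; exact eq_neg_of_add_eq_zero_right h₄
    have k₃ : ⁅x, a⁆ = ⁅y, x⁆ := by rw [← lie_skew, h₃', neg_neg]
    have k₄ : ⁅z, b⁆ = ⁅y, z⁆ := by rw [← lie_skew, h₄', neg_neg]
    have k₅ : ⁅y, b⁆ = -⁅y, z⁆ := by rw [← lie_skew, h₅]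
    have k₆ : ⁅y, a⁆ = -⁅y, x⁆ := by rw [← lie_skew, h₆]
    have cover : ∀ i j l m : Fin 5, i < j → l < m → i < l → j ≠ l → j ≠ m →
        (i, j, l, m) ∈ ([(0, 1, 2, 3), (0, 1, 2, 4), (0, 1, 3, 4), (0, 2, 1, 3), (0, 2, 1, 4),
            (0, 2, 3, 4), (0, 3, 1, 2), (0, 3, 1, 4), (0, 3, 2, 4), (0, 4, 1, 2),
            (0, 4, 1, 3), (0, 4, 2, 3), (1, 2, 3, 4), (1, 3, 2, 4), (1, 4, 2, 3)] :
            List (Fin 5 × Fin 5 × Fin 5 × Fin 5)) := by decide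
    have key' : ∀ i j l m : Fin 5, i < j → l < m → i < l → j ≠ l → j ≠ m →
        ⁅fiveTable a b x y z i j, fiveTable a b x y z l m⁆ = 0 := by
      intro i j l m h7 h8 h9 h10 h11
      have h := cover i j l m h7 h8 h9 h10 h11
      clear h7 h8 h9 h10 h11 cover
      simp only [List.mem_cons, List.not_mem_nil, or_false, Prod.mk.injEq] at h
      rcases h with h | h | h | h | h | h | h | h | h | h | h | h | h | h | h <;>
      obtain ⟨rfl, rfl, rfl, rfl⟩ := h <;>
      simp only [fiveTable, Matrix.of_apply, Matrix.cons_val', Matrix.cons_val, lie_add,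
          add_lie, lie_sub, sub_lie, lie_neg, neg_lie, lie_self,
          h₁, h₂, h₃', h₄', h₅, h₆, k₁, k₂, k₃, k₄, k₅, k₆, s₁, s₂, s₃, s₄] <;>
      try abel
    have key : ∀ i j l m : Fin 5, i < j → l < m → i ≠ l → i ≠ m → j ≠ l → j ≠ m →
        ⁅fiveTable a b x y z i j, fiveTable a b x y z l m⁆ = 0 := by
      intro i j l m hij hlm h13 h14 h23 h24
      rcases lt_or_gt_of_ne h13 with h' | h'
      · exact key' i j l m hij hlm h' h23 h24
      · rw [← lie_skew, key' l m i j hlm hij h' (Ne.symm h14) (Ne.symm h24), neg_zero]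
    have symm : ∀ i j, fiveTable a b x y z j i = fiveTable a b x y z i j := fun i j => by
      fin_cases i <;> fin_cases j <;> rfl
    intro i j l m hij h13 h14 h23 h24 h34
    rcases lt_or_gt_of_ne hij with h | h <;> rcases lt_or_gt_of_ne h34 with h' | h'
    · exact key i j l m h h' h13 h14 h23 h24
    · rw [symm m l]; exact key i j m l h h' h14 h13 h24 h23
    · rw [symm j i]; exact key j i l m h h' h23 h24 h13 h14
    · rw [symm j i, symm m l]; exact key j i m l h h' h24 h23 h14 h13

variable {k : Type u} [CommRing k] [Algebra ℚ k]

theorem eq_zero_of_two_smul {L : Type v} [AddCommGroup L] [Module k L] {t : L} (h : t + t = 0) :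
    t = 0 := by
  have h2 : (algebraMap ℚ k (1 / 2)) * 2 = 1 := by
    rw [← map_ofNat (algebraMap ℚ k) 2, ← map_mul]; norm_num
  calc t = ((algebraMap ℚ k (1 / 2)) * 2) • t := by rw [h2, one_smul]
    _ = (algebraMap ℚ k (1 / 2)) • (t + t) := by rw [mul_smul, two_smul]
    _ = 0 := by rw [h, smul_zero]

variable (k) in
theorem eq_fiveTable {L : Type v} [LieRing L] [LieAlgebra k L] {f : Fin 5 → Fin 5 → L}
    (hf : SphereBraidRel f) : f = fiveTable (f 0 1) (f 1 2) (f 0 4) (f 1 4) (f 2 4) := by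
  have r0 := hf.sum 0
  have r1 := hf.sum 1
  have r2 := hf.sum 2
  have r3 := hf.sum 3
  have r4 := hf.sum 4
  simp only [Fin.sum_univ_five, hf.diag, hf.symm 0 1, hf.symm 0 2, hf.symm 0 3, hf.symm 0 4,
    hf.symm 1 2, hf.symm 1 3, hf.symm 1 4, hf.symm 2 3, hf.symm 2 4, hf.symm 3 4] at r0 r1 r2 r3 r4
  have e34 : f 3 4 = -(f 0 4 + f 1 4 + f 2 4) := by linear_combination (norm := abel) r4
  have e02 : f 0 2 = -(f 0 4 + f 1 4 + f 2 4) - f 0 1 - f 1 2 := by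
    rw [← sub_eq_zero]
    refine eq_zero_of_two_smul (k := k) ?_
    linear_combination (norm := abel) r0 + r1 + r2 - r3 + r4
  have e03 : f 0 3 = f 1 2 + f 1 4 + f 2 4 := by
    linear_combination (norm := abel) r0 - e02
  have e23 : f 2 3 = f 0 1 + f 0 4 + f 1 4 := by
    linear_combination (norm := abel) r2 - e02
  have e13 : f 1 3 = - f 1 4 - f 0 1 - f 1 2 := by
    linear_combination (norm := abel) r1
  funext i j
  fin_cases i <;> fin_cases j <;>
    simp [fiveTable, hf.diag, hf.symm 0 1, hf.symm 0 2, hf.symm 0 3, hf.symm 0 4,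
    hf.symm 1 2, hf.symm 1 3, hf.symm 1 4, hf.symm 2 3, hf.symm 2 4, hf.symm 3 4, e34, e02, e03,
    e23, e13]

end FiveStrands


/-! ### The morphisms between `𝔣₂`, `𝔭₄`, `𝔭₅` and their enveloping algebras -/

section Morphisms

variable (k : Type u) [CommRing k]

/-- The free Lie algebra `𝔣₂` on two generators. -/
abbrev F2 : Type u := FreeLieAlgebra k (Fin 2)

/-- The generators of `𝔣₂`: `x_0 = e_0` and `x_1 = -e_1`. -/
def f2e0 : F2 k := FreeLieAlgebra.of k 0

/-- The generator `e_1` of `𝔣₂`. -/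
def f2e1 : F2 k := FreeLieAlgebra.of k 1

/-- `U(𝔣₂)`. -/
abbrev UF2 : Type u := UniversalEnvelopingAlgebra k (F2 k)

/-- `U(𝔭_n)`. -/
abbrev UP (n : ℕ) : Type u := UniversalEnvelopingAlgebra k (SphereBraid k n)

/-- The element `e_0` of `U(𝔣₂)`. -/
def e0 : UF2 k := UniversalEnvelopingAlgebra.ι k (f2e0 k)

/-- The element `e_1` of `U(𝔣₂)`. -/
def e1 : UF2 k := UniversalEnvelopingAlgebra.ι k (f2e1 k)

/-- The generator `e_{i+1,j+1}` of `U(𝔭_n)`. -/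
def UE {n : ℕ} (i j : Fin n) : UP k n := UniversalEnvelopingAlgebra.ι k (E k i j)

/-- The grading of `U(𝔣₂)`: `e_0` and `e_1` have degree `1`. -/
def degF2 (n : ℕ) : Submodule k (UF2 k) := (Submodule.span k {e0 k, e1 k}) ^ n

/-- The grading of `U(𝔭_m)`: the generators `e_{ij}` have degree `1`. -/
def degP (m : ℕ) (n : ℕ) : Submodule k (UP k m) :=
  (Submodule.span k {t | ∃ i j : Fin m, t = UE k i j}) ^ n

variable {k}

/-- The morphism of enveloping algebras induced by a morphism of Lie algebras. -/
def mapU {L : Type v} {L' : Type v'} [LieRing L] [LieAlgebra k L] [LieRing L'] [LieAlgebra k L']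
    (f : L →ₗ⁅k⁆ L') : UniversalEnvelopingAlgebra k L →ₐ[k] UniversalEnvelopingAlgebra k L' :=
  UniversalEnvelopingAlgebra.lift k ((UniversalEnvelopingAlgebra.ι k).comp f)

theorem mapU_ι {L : Type v} {L' : Type v'} [LieRing L] [LieAlgebra k L] [LieRing L']
    [LieAlgebra k L'] (f : L →ₗ⁅k⁆ L') (x : L) :
    mapU f (UniversalEnvelopingAlgebra.ι k x) = UniversalEnvelopingAlgebra.ι k (f x) :=
  UniversalEnvelopingAlgebra.lift_ι_apply k _ x

variable (k)

/-- The table of values in `𝔣₂` of the generators `e_{ij}` of `𝔭₄`, where `e_∞ = -e_0 - e_1`. -/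
def tableP4F2 : Fin 4 → Fin 4 → F2 k :=
  !![0, f2e1 k, -f2e0 k - f2e1 k, f2e0 k;
     f2e1 k, 0, f2e0 k, -f2e0 k - f2e1 k;
     -f2e0 k - f2e1 k, f2e0 k, 0, f2e1 k;
     f2e0 k, -f2e0 k - f2e1 k, f2e1 k, 0]

/-- In `𝔭₄`: `e_0 = e_14`. -/
def p4e0 : SphereBraid k 4 := E k 0 3

/-- In `𝔭₄`: `e_1 = e_12`. -/
def p4e1 : SphereBraid k 4 := E k 0 1

/-- In `𝔭₄`: `e_∞ = -e_0 - e_1`. -/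
def p4einf : SphereBraid k 4 := -p4e0 k - p4e1 k

/-- The table of `pr_1 : 𝔭₅ → 𝔭₄`. -/
def tablePr1 : Fin 5 → Fin 5 → SphereBraid k 4 :=
  !![0, 0, 0, 0, 0;
     0, 0, p4e0 k, p4einf k, p4e1 k;
     0, p4e0 k, 0, p4e1 k, p4einf k;
     0, p4einf k, p4e1 k, 0, p4e0 k;
     0, p4e1 k, p4einf k, p4e0 k, 0]

/-- The table of `pr_2 : 𝔭₅ → 𝔭₄`. -/
def tablePr2 : Fin 5 → Fin 5 → SphereBraid k 4 :=
  !![0, 0, p4einf k, p4e0 k, p4e1 k;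
     0, 0, 0, 0, 0;
     p4einf k, 0, 0, p4e1 k, p4e0 k;
     p4e0 k, 0, p4e1 k, 0, p4einf k;
     p4e1 k, 0, p4e0 k, p4einf k, 0]

/-- The table of `pr_5 : 𝔭₅ → 𝔭₄`. -/
def tablePr5 : Fin 5 → Fin 5 → SphereBraid k 4 :=
  !![0, p4e1 k, p4einf k, p4e0 k, 0;
     p4e1 k, 0, p4e0 k, p4einf k, 0;
     p4einf k, p4e0 k, 0, p4e1 k, 0;
     p4e0 k, p4einf k, p4e1 k, 0, 0;
     0, 0, 0, 0, 0]

variable {k}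

/-- A table whose entries are `0, a, b, c` with `a + b + c = 0`, as prescribed by `t`. -/
theorem rel_of_code {n : ℕ} {L : Type v} [LieRing L] {f : Fin n → Fin n → L} (a b c : L)
    (habc : a + b + c = 0) (t : Fin n → Fin n → Fin 4) (hf : ∀ i j, f i j = ![0, a, b, c] (t i j))
    (diag : ∀ i, t i i = 0) (symm : ∀ i j, t j i = t i j)
    (sum : ∀ i, (∀ j, t i j = 0) ∨ ∀ s : Fin 4, s ≠ 0 → ∃ j, ∀ j', t i j' = s ↔ j' = j)
    (comm : ∀ i j l m, i ≠ j → i ≠ l → i ≠ m → j ≠ l → j ≠ m → l ≠ m →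
      t i j = 0 ∨ t l m = 0 ∨ t i j = t l m) : SphereBraidRel f where
  diag i := by rw [hf, diag]; rfl
  symm i j := by rw [hf, hf, symm]
  sum i := by
    simp only [hf]
    rcases sum i with h | h
    · exact Finset.sum_eq_zero fun j _ => by rw [h]; rfl
    · have key : ∀ s : Fin 4, ![0, a, b, c] s = (if s = 1 then a else 0) + (if s = 2 then b else 0) +
          (if s = 3 then c else 0) := by
        intro s; fin_cases s <;> simp
      obtain ⟨j₁, h₁⟩ := h 1 (by decide)
      obtain ⟨j₂, h₂⟩ := h 2 (by decide)
      obtain ⟨j₃, h₃⟩ := h 3 (by decide)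
      simp only [key, h₁, h₂, h₃, Finset.sum_add_distrib, Finset.sum_ite_eq', Finset.mem_univ,
        if_true, habc]
  comm i j l m h₁ h₂ h₃ h₄ h₅ h₆ := by
    have h0 : (![0, a, b, c] : Fin 4 → L) 0 = 0 := rfl
    rw [hf, hf]
    rcases comm i j l m h₁ h₂ h₃ h₄ h₅ h₆ with h | h | h
    · rw [h, h0, zero_lie]
    · rw [h, h0, lie_zero]
    · rw [h, lie_self]

variable (k)

theorem rel_tableP4F2 : SphereBraidRel (tableP4F2 k) := by
  refine rel_of_code (f2e0 k) (f2e1 k) (-f2e0 k - f2e1 k) (by abel)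
    ![![0, 2, 3, 1], ![2, 0, 1, 3], ![3, 1, 0, 2], ![1, 3, 2, 0]]
    (fun i j => ?_) (by decide) (by decide) (by decide) (by decide)
  fin_cases i <;> fin_cases j <;> rfl

theorem rel_tablePr1 : SphereBraidRel (tablePr1 k) := by
  refine rel_of_code (p4e0 k) (p4e1 k) (p4einf k) (by rw [p4einf]; abel)
    ![![0, 0, 0, 0, 0], ![0, 0, 1, 3, 2], ![0, 1, 0, 2, 3], ![0, 3, 2, 0, 1], ![0, 2, 3, 1, 0]]
    (fun i j => ?_) (by decide) (by decide) (by decide) (by decide)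
  fin_cases i <;> fin_cases j <;> rfl

theorem rel_tablePr2 : SphereBraidRel (tablePr2 k) := by
  refine rel_of_code (p4e0 k) (p4e1 k) (p4einf k) (by rw [p4einf]; abel)
    ![![0, 0, 3, 1, 2], ![0, 0, 0, 0, 0], ![3, 0, 0, 2, 1], ![1, 0, 2, 0, 3], ![2, 0, 1, 3, 0]]
    (fun i j => ?_) (by decide) (by decide) (by decide) (by decide)
  fin_cases i <;> fin_cases j <;> rfl

theorem rel_tablePr5 : SphereBraidRel (tablePr5 k) := by
  refine rel_of_code (p4e0 k) (p4e1 k) (p4einf k) (by rw [p4einf]; abel)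
    ![![0, 2, 3, 1, 0], ![2, 0, 1, 3, 0], ![3, 1, 0, 2, 0], ![1, 3, 2, 0, 0], ![0, 0, 0, 0, 0]]
    (fun i j => ?_) (by decide) (by decide) (by decide) (by decide)
  fin_cases i <;> fin_cases j <;> rfl

/-- The morphism `𝔭₄ → 𝔣₂`. -/
def p4ToF2 : SphereBraid k 4 →ₗ⁅k⁆ F2 k := SphereBraid.lift (tableP4F2 k) (rel_tableP4F2 k)

/-- The morphism `𝔣₂ → 𝔭₄`, `e_0 ↦ e_14`, `e_1 ↦ e_12`. -/
def f2ToP4 : F2 k →ₗ⁅k⁆ SphereBraid k 4 := FreeLieAlgebra.lift k ![p4e0 k, p4e1 k]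

theorem p4ToF2_comp : (p4ToF2 k).comp (f2ToP4 k) = LieHom.id := by
  refine FreeLieAlgebra.hom_ext fun i => ?_
  rw [LieHom.comp_apply, f2ToP4, FreeLieAlgebra.lift_of_apply, p4ToF2]
  fin_cases i
  · exact SphereBraid.lift_E _ _ _ _
  · exact SphereBraid.lift_E _ _ _ _

variable [Algebra ℚ k]

theorem f2ToP4_comp : (f2ToP4 k).comp (p4ToF2 k) = LieHom.id := by
  have hf := sphereBraidRel_E (k := k) 4
  have r0 := hf.sum 0
  have r1 := hf.sum 1
  have r2 := hf.sum 2
  have r3 := hf.sum 3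
  simp only [Fin.sum_univ_four, hf.diag, hf.symm 0 1, hf.symm 0 2, hf.symm 0 3,
    hf.symm 1 2, hf.symm 1 3, hf.symm 2 3] at r0 r1 r2 r3
  have e23 : E k (2 : Fin 4) 3 = E k 0 1 := by
    rw [← sub_eq_zero]
    refine eq_zero_of_two_smul (k := k) ?_
    linear_combination (norm := abel) r2 + r3 - r0 - r1
  have e12 : E k (1 : Fin 4) 2 = E k 0 3 := by
    rw [← sub_eq_zero]
    refine eq_zero_of_two_smul (k := k) ?_
    linear_combination (norm := abel) r2 + r1 - r0 - r3
  have e02 : E k (0 : Fin 4) 2 = - E k 0 3 - E k 0 1 := by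
    linear_combination (norm := abel) r0
  have e13 : E k (1 : Fin 4) 3 = - E k 0 3 - E k 0 1 := by
    linear_combination (norm := abel) r1 - e12
  have s0 : f2ToP4 k (f2e0 k) = E k 0 3 := by simp [f2ToP4, f2e0, p4e0]
  have s1 : f2ToP4 k (f2e1 k) = E k 0 1 := by simp [f2ToP4, f2e1, p4e1]
  refine SphereBraid.hom_ext fun i j => ?_
  rw [LieHom.comp_apply, p4ToF2, SphereBraid.lift_E]
  fin_cases i <;> fin_cases j <;>
    simp [tableP4F2, s0, s1, hf.diag, hf.symm 0 1, hf.symm 0 2, hf.symm 0 3,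
    hf.symm 1 2, hf.symm 1 3, hf.symm 2 3, e23, e12, e02, e13]

/-- The isomorphism `𝔭₄ ≃ 𝔣₂`, `e_0 = e_14 = e_23`, `e_1 = e_12 = e_34`. -/
def p4EquivF2 : SphereBraid k 4 ≃ₗ⁅k⁆ F2 k :=
  { p4ToF2 k with
    invFun := f2ToP4 k
    left_inv := fun x => DFunLike.congr_fun (f2ToP4_comp k) x
    right_inv := fun x => DFunLike.congr_fun (p4ToF2_comp k) x }

/-- `pr_1 : 𝔭₅ → 𝔭₄`. -/
def pr1 : SphereBraid k 5 →ₗ⁅k⁆ SphereBraid k 4 := SphereBraid.lift (tablePr1 k) (rel_tablePr1 k)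

/-- `pr_2 : 𝔭₅ → 𝔭₄`. -/
def pr2 : SphereBraid k 5 →ₗ⁅k⁆ SphereBraid k 4 := SphereBraid.lift (tablePr2 k) (rel_tablePr2 k)

/-- `pr_5 : 𝔭₅ → 𝔭₄`. -/
def pr5 : SphereBraid k 5 →ₗ⁅k⁆ SphereBraid k 4 := SphereBraid.lift (tablePr5 k) (rel_tablePr5 k)

/-- `ℓ : 𝔭₄ → 𝔭₅`, `e_0 ↦ e_23`, `e_1 ↦ e_12`. -/
def ell : SphereBraid k 4 →ₗ⁅k⁆ SphereBraid k 5 :=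
  (FreeLieAlgebra.lift k ![E k 1 2, E k 0 1] : F2 k →ₗ⁅k⁆ SphereBraid k 5).comp
    (p4EquivF2 k).toLieHom

/-- `U(𝔭₅) → U(𝔣₂)` induced by `pr_1`. -/
def Upr1 : UP k 5 →ₐ[k] UF2 k := mapU ((p4EquivF2 k).toLieHom.comp (pr1 k))

/-- `U(𝔭₅) → U(𝔣₂)` induced by `pr_2`. -/
def Upr2 : UP k 5 →ₐ[k] UF2 k := mapU ((p4EquivF2 k).toLieHom.comp (pr2 k))

/-- `U(𝔭₅) → U(𝔭₄)` induced by `pr_5`. -/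
def Upr5 : UP k 5 →ₐ[k] UP k 4 := mapU (pr5 k)

/-- `U(𝔣₂) ≃ U(𝔭₄) → U(𝔭₅)` induced by `ℓ`. -/
def Uell : UF2 k →ₐ[k] UP k 5 := mapU ((ell k).comp (p4EquivF2 k).symm.toLieHom)

/-- `pr_12 : U(𝔭₅) → U(𝔣₂)^{⊗2}`, the morphism such that `x ↦ pr_1(x) ⊗ 1 + 1 ⊗ pr_2(x)` for
`x ∈ 𝔭₅`. -/
def Upr12 : UP k 5 →ₐ[k] UF2 k ⊗[k] UF2 k :=
  UniversalEnvelopingAlgebra.lift k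
    { toFun := fun x =>
        Upr1 k (UniversalEnvelopingAlgebra.ι k x) ⊗ₜ[k] 1 +
          1 ⊗ₜ[k] Upr2 k (UniversalEnvelopingAlgebra.ι k x)
      map_add' := fun x y => by
        simp only [map_add, TensorProduct.add_tmul, TensorProduct.tmul_add]; abel
      map_smul' := fun c x => by
        simp only [map_smul, TensorProduct.smul_tmul', TensorProduct.tmul_smul, smul_add,
          RingHom.id_apply]
      map_lie' := fun {x y} => by
        simp only [LieHom.map_lie, LieRing.of_associative_ring_bracket, map_sub, map_mul,
          TensorProduct.sub_tmul, TensorProduct.tmul_sub, mul_add, add_mul,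
          Algebra.TensorProduct.tmul_mul_tmul, mul_one, one_mul]
        abel }

end Morphisms


/-! ### The ideal `J(pr_5)` is free on `e_15, e_25, e_35` -/

section Freeness

section Matrices

variable {R : Type v} [Ring R]

def matA (a x y : R) : Matrix (Fin 4) (Fin 4) R :=
  !![a, 0, 0, 0; 0, a + y, -x, 0; 0, -y, a + x, 0; 0, 0, 0, a]

def matB (b y z : R) : Matrix (Fin 4) (Fin 4) R :=
  !![b, 0, 0, 0; 0, b, 0, 0; 0, 0, b + z, -y; 0, 0, -z, b + y]

def matX (x y z : R) : Matrix (Fin 4) (Fin 4) R :=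
  !![0, 1, 0, 0; 0, x, 0, 0; 0, y, 0, 0; 0, z, 0, 0]

def matY (x y z : R) : Matrix (Fin 4) (Fin 4) R :=
  !![0, 0, 1, 0; 0, 0, x, 0; 0, 0, y, 0; 0, 0, z, 0]

def matZ (x y z : R) : Matrix (Fin 4) (Fin 4) R :=
  !![0, 0, 0, 1; 0, 0, 0, x; 0, 0, 0, y; 0, 0, 0, z]

theorem mul_four (a00 a01 a02 a03 a10 a11 a12 a13 a20 a21 a22 a23 a30 a31 a32 a33 : R)
    (b00 b01 b02 b03 b10 b11 b12 b13 b20 b21 b22 b23 b30 b31 b32 b33 : R) :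
    (!![a00, a01, a02, a03; a10, a11, a12, a13; a20, a21, a22, a23; a30, a31, a32, a33] :
      Matrix (Fin 4) (Fin 4) R) *
    !![b00, b01, b02, b03; b10, b11, b12, b13; b20, b21, b22, b23; b30, b31, b32, b33] =
    Matrix.of fun i j =>
      ![a00, a10, a20, a30] i * ![b00, b01, b02, b03] j +
      ![a01, a11, a21, a31] i * ![b10, b11, b12, b13] j +
      ![a02, a12, a22, a32] i * ![b20, b21, b22, b23] j +
      ![a03, a13, a23, a33] i * ![b30, b31, b32, b33] j := by
  ext i j
  rw [Matrix.mul_apply, Fin.sum_univ_four]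
  fin_cases i <;> fin_cases j <;> rfl

theorem ext_four {M N : Matrix (Fin 4) (Fin 4) R}
    (h : ∀ i j, M i j = N i j) : M = N := Matrix.ext h

theorem rel_matrices {a b x y z : R} (h₁ : a * z = z * a) (h₂ : b * x = x * b)
    (h₃ : a * x = x * a - y * x + x * y) (h₄ : a * y = y * a + y * x - x * y)
    (h₅ : b * y = y * b + y * z - z * y) (h₆ : b * z = z * b - y * z + z * y) :
    SphereBraidRel
      (fiveTable (matA a x y) (matB b y z) (matX x y z) (matY x y z) (matZ x y z)) := by
  apply sphereBraidRel_fiveTable <;>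
  · simp only [Ring.lie_def, matA, matB, matX, matY, matZ, mul_four]
    refine ext_four fun i j => ?_
    simp only [Matrix.add_apply, Matrix.sub_apply, Matrix.zero_apply, Matrix.of_apply]
    fin_cases i <;> fin_cases j <;>
      simp only [Fin.zero_eta, Fin.mk_one, Fin.reduceFinMk, Matrix.cons_val, mul_zero, zero_mul,
        mul_one, one_mul, add_zero, zero_add, mul_neg, neg_mul, mul_add, add_mul,
        sub_self, h₁, h₂, h₃, h₄, h₅, h₆] <;>
      try abel

end Matrices

variable (k : Type u) [CommRing k] [Algebra ℚ k]

theorem five_eq : E k (n := 5) = fiveTable (E k 0 1) (E k 1 2) (E k 0 4) (E k 1 4) (E k 2 4) :=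
  eq_fiveTable k (sphereBraidRel_E 5)

theorem five_eq_apply (i j : Fin 5) :
    E k i j = fiveTable (E k 0 1) (E k 1 2) (E k 0 4) (E k 1 4) (E k 2 4) i j :=
  congrFun (congrFun (five_eq k) i) j

theorem UE_comm (i j l m : Fin 5) (h₁ : i ≠ j) (h₂ : i ≠ l) (h₃ : i ≠ m) (h₄ : j ≠ l)
    (h₅ : j ≠ m) (h₆ : l ≠ m) : UE k i j * UE k l m = UE k l m * UE k i j := by
  have h := congrArg (UniversalEnvelopingAlgebra.ι k)
    ((sphereBraidRel_E (k := k) 5).comm i j l m h₁ h₂ h₃ h₄ h₅ h₆)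
  rw [LieHom.map_lie, map_zero, LieRing.of_associative_ring_bracket] at h
  exact sub_eq_zero.1 h

theorem UE_34 : UE k (3 : Fin 5) 4 = -(UE k 0 4 + UE k 1 4 + UE k 2 4) := by
  have h := five_eq_apply k 3 4
  simp only [UE, ← map_add, ← map_neg]
  exact congrArg _ h

theorem UE_03 : UE k (0 : Fin 5) 3 = UE k 1 2 + UE k 1 4 + UE k 2 4 := by
  have h := five_eq_apply k 0 3
  simp only [UE, ← map_add]
  exact congrArg _ h

theorem UE_23 : UE k (2 : Fin 5) 3 = UE k 0 1 + UE k 0 4 + UE k 1 4 := by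
  have h := five_eq_apply k 2 3
  simp only [UE, ← map_add]
  exact congrArg _ h

theorem rel₁ : UE k (0 : Fin 5) 1 * UE k 2 4 = UE k 2 4 * UE k 0 1 := by
  apply UE_comm <;> decide

theorem rel₂ : UE k (1 : Fin 5) 2 * UE k 0 4 = UE k 0 4 * UE k 1 2 := by
  apply UE_comm <;> decide

theorem rel₄ : UE k (0 : Fin 5) 1 * UE k 1 4 =
    UE k 1 4 * UE k 0 1 + UE k 1 4 * UE k 0 4 - UE k 0 4 * UE k 1 4 := by
  have h : UE k (1 : Fin 5) 4 * UE k 2 3 = UE k 2 3 * UE k 1 4 := by apply UE_comm <;> decide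
  rw [UE_23, mul_add, mul_add, add_mul, add_mul] at h
  linear_combination (norm := abel) -h

theorem rel₃ : UE k (0 : Fin 5) 1 * UE k 0 4 =
    UE k 0 4 * UE k 0 1 - UE k 1 4 * UE k 0 4 + UE k 0 4 * UE k 1 4 := by
  have h : UE k (0 : Fin 5) 1 * UE k 3 4 = UE k 3 4 * UE k 0 1 := by apply UE_comm <;> decide
  rw [UE_34, mul_neg, neg_mul, mul_add, mul_add, add_mul, add_mul, rel₁, rel₄] at h
  linear_combination (norm := abel) -h

theorem rel₅ : UE k (1 : Fin 5) 2 * UE k 1 4 =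
    UE k 1 4 * UE k 1 2 + UE k 1 4 * UE k 2 4 - UE k 2 4 * UE k 1 4 := by
  have h : UE k (1 : Fin 5) 4 * UE k 0 3 = UE k 0 3 * UE k 1 4 := by apply UE_comm <;> decide
  rw [UE_03, mul_add, mul_add, add_mul, add_mul] at h
  linear_combination (norm := abel) -h

theorem rel₆ : UE k (1 : Fin 5) 2 * UE k 2 4 =
    UE k 2 4 * UE k 1 2 - UE k 1 4 * UE k 2 4 + UE k 2 4 * UE k 1 4 := by
  have h : UE k (1 : Fin 5) 2 * UE k 3 4 = UE k 3 4 * UE k 1 2 := by apply UE_comm <;> decide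
  rw [UE_34, mul_neg, neg_mul, mul_add, mul_add, add_mul, add_mul, rel₂, rel₅] at h
  linear_combination (norm := abel) -h

/-- The five elements `e_12, e_23, e_15, e_25, e_35`. -/
def fiveGen : Set (UP k 5) := {UE k 0 1, UE k 1 2, UE k 0 4, UE k 1 4, UE k 2 4}

theorem span_fiveGen :
    Submodule.span k {t | ∃ i j : Fin 5, t = UE k i j} = Submodule.span k (fiveGen k) := by
  apply le_antisymm
  · rw [Submodule.span_le]
    rintro t ⟨i, j, rfl⟩
    have m1 : UE k 0 1 ∈ Submodule.span k (fiveGen k) := Submodule.subset_span (by simp [fiveGen])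
    have m2 : UE k 1 2 ∈ Submodule.span k (fiveGen k) := Submodule.subset_span (by simp [fiveGen])
    have m3 : UE k 0 4 ∈ Submodule.span k (fiveGen k) := Submodule.subset_span (by simp [fiveGen])
    have m4 : UE k 1 4 ∈ Submodule.span k (fiveGen k) := Submodule.subset_span (by simp [fiveGen])
    have m5 : UE k 2 4 ∈ Submodule.span k (fiveGen k) := Submodule.subset_span (by simp [fiveGen])
    have key : ∀ i j, (fiveTable (E k 0 1) (E k 1 2) (E k 0 4) (E k 1 4) (E k 2 4) i j) ∈
        (Submodule.span k (fiveGen k)).comap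
          (UniversalEnvelopingAlgebra.ι k : SphereBraid k 5 →ₗ⁅k⁆ UP k 5).toLinearMap := by
      have n1 : E k 0 1 ∈ (Submodule.span k (fiveGen k)).comap
          (UniversalEnvelopingAlgebra.ι k : SphereBraid k 5 →ₗ⁅k⁆ UP k 5).toLinearMap := m1
      have n2 : E k 1 2 ∈ (Submodule.span k (fiveGen k)).comap
          (UniversalEnvelopingAlgebra.ι k : SphereBraid k 5 →ₗ⁅k⁆ UP k 5).toLinearMap := m2
      have n3 : E k 0 4 ∈ (Submodule.span k (fiveGen k)).comap
          (UniversalEnvelopingAlgebra.ι k : SphereBraid k 5 →ₗ⁅k⁆ UP k 5).toLinearMap := m3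
      have n4 : E k 1 4 ∈ (Submodule.span k (fiveGen k)).comap
          (UniversalEnvelopingAlgebra.ι k : SphereBraid k 5 →ₗ⁅k⁆ UP k 5).toLinearMap := m4
      have n5 : E k 2 4 ∈ (Submodule.span k (fiveGen k)).comap
          (UniversalEnvelopingAlgebra.ι k : SphereBraid k 5 →ₗ⁅k⁆ UP k 5).toLinearMap := m5
      generalize (Submodule.span k (fiveGen k)).comap
          (UniversalEnvelopingAlgebra.ι k : SphereBraid k 5 →ₗ⁅k⁆ UP k 5).toLinearMap = S at *
      have n6 := S.neg_mem (S.add_mem (S.add_mem n3 n4) n5)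
      have n7 := S.sub_mem (S.sub_mem n6 n1) n2
      have n8 := S.add_mem (S.add_mem n2 n4) n5
      have n9 := S.sub_mem (S.sub_mem (S.neg_mem n4) n1) n2
      have n10 := S.add_mem (S.add_mem n1 n3) n4
      have n0 := S.zero_mem
      intro i j
      fin_cases i <;> fin_cases j <;> assumption
    have h := key i j
    rw [← five_eq_apply] at h
    exact h
  · rw [Submodule.span_le]
    intro t ht
    simp only [fiveGen, Set.mem_insert_iff, Set.mem_singleton_iff] at ht
    rcases ht with rfl | rfl | rfl | rfl | rfl <;> exact Submodule.subset_span ⟨_, _, rfl⟩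

theorem adjoin_fiveGen : Algebra.adjoin k (fiveGen k) = ⊤ := by
  let S := Algebra.adjoin k (fiveGen k)
  have hE : ∀ i j : Fin 5, UE k i j ∈ S := by
    intro i j
    have h : UE k i j ∈ Submodule.span k {t | ∃ i j : Fin 5, t = UE k i j} :=
      Submodule.subset_span ⟨i, j, rfl⟩
    rw [span_fiveGen] at h
    exact Algebra.span_le_adjoin k _ h
  have hr := sphereBraidRel_E (k := k) 5
  have hS : SphereBraidRel (fun i j : Fin 5 => (⟨UE k i j, hE i j⟩ : S)) :=
    { diag := fun i => Subtype.ext (by simp [UE, hr.diag])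
      symm := fun i j => Subtype.ext (by simp [UE, hr.symm i j])
      sum := fun i => Subtype.ext (by
        have h := congrArg (UniversalEnvelopingAlgebra.ι k) (hr.sum i)
        rw [map_sum, map_zero] at h
        rw [AddSubmonoidClass.coe_finsetSum]
        exact h)
      comm := fun i j l m h₁ h₂ h₃ h₄ h₅ h₆ => Subtype.ext (by
        have h := UE_comm k i j l m h₁ h₂ h₃ h₄ h₅ h₆
        rw [LieRing.of_associative_ring_bracket]
        exact sub_eq_zero.2 h) }
  let F : UP k 5 →ₐ[k] S := UniversalEnvelopingAlgebra.lift k (SphereBraid.lift _ hS)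
  have hF : S.val.comp F = AlgHom.id k _ := by
    apply UniversalEnvelopingAlgebra.hom_ext
    apply SphereBraid.hom_ext
    intro i j
    change S.val (F (UniversalEnvelopingAlgebra.ι k (E k i j))) = UE k i j
    rw [UniversalEnvelopingAlgebra.lift_ι_apply, SphereBraid.lift_E]
    rfl
  rw [eq_top_iff]
  intro x _
  have h := DFunLike.congr_fun hF x
  have h2 : x = (F x : UP k 5) := h.symm
  rw [h2]
  exact (F x).2

/-- The block triangular morphism whose blocks are `ℓ ∘ pr_5`, the coordinates, and `ϖ`. -/
def Psi : UP k 5 →ₐ[k] Matrix (Fin 4) (Fin 4) (UP k 5) :=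
  UniversalEnvelopingAlgebra.lift k (SphereBraid.lift _
    (rel_matrices (rel₁ k) (rel₂ k) (rel₃ k) (rel₄ k) (rel₅ k) (rel₆ k)))

theorem Psi_UE (i j : Fin 5) : Psi k (UE k i j) =
    fiveTable (matA (UE k 0 1) (UE k 0 4) (UE k 1 4)) (matB (UE k 1 2) (UE k 1 4) (UE k 2 4))
      (matX (UE k 0 4) (UE k 1 4) (UE k 2 4)) (matY (UE k 0 4) (UE k 1 4) (UE k 2 4))
      (matZ (UE k 0 4) (UE k 1 4) (UE k 2 4)) i j := by
  rw [Psi, UE.eq_1 k i j, UniversalEnvelopingAlgebra.lift_ι_apply, SphereBraid.lift_E]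

theorem Psi_a : Psi k (UE k 0 1) = matA (UE k 0 1) (UE k 0 4) (UE k 1 4) := Psi_UE k 0 1
theorem Psi_b : Psi k (UE k 1 2) = matB (UE k 1 2) (UE k 1 4) (UE k 2 4) := Psi_UE k 1 2
theorem Psi_x : Psi k (UE k 0 4) = matX (UE k 0 4) (UE k 1 4) (UE k 2 4) := Psi_UE k 0 4
theorem Psi_y : Psi k (UE k 1 4) = matY (UE k 0 4) (UE k 1 4) (UE k 2 4) := Psi_UE k 1 4
theorem Psi_z : Psi k (UE k 2 4) = matZ (UE k 0 4) (UE k 1 4) (UE k 2 4) := Psi_UE k 2 4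

/-- The generators `e_15, e_25, e_35` of `J(pr_5)`. -/
def jgen (i : Fin 3) : UP k 5 := UE k i.castSucc.castSucc 4

/-- The column `(1, e_15, e_25, e_35)`. -/
def colHat : Fin 4 → UP k 5 := ![1, UE k 0 4, UE k 1 4, UE k 2 4]

theorem Psi_colHat (u : UP k 5) (i : Fin 4) :
    ∑ j, Psi k u i j * colHat k j = colHat k i * u := by
  have hu : u ∈ Algebra.adjoin k (fiveGen k) := by rw [adjoin_fiveGen]; trivial
  induction hu using Algebra.adjoin_induction generalizing i with
  | mem t ht =>
    simp only [fiveGen, Set.mem_insert_iff, Set.mem_singleton_iff] at ht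
    have r1 := rel₁ k
    have r2 := rel₂ k
    have r3 := rel₃ k
    have r4 := rel₄ k
    have r5 := rel₅ k
    have r6 := rel₆ k
    rcases ht with rfl | rfl | rfl | rfl | rfl
    · rw [Psi_a]
      fin_cases i <;> simp [matA, colHat, Fin.sum_univ_four, add_mul, r1, r2, r3, r4, r5, r6] <;>
        abel
    · rw [Psi_b]
      fin_cases i <;> simp [matB, colHat, Fin.sum_univ_four, add_mul, r1, r2, r3, r4, r5, r6] <;>
        abel
    · rw [Psi_x]
      fin_cases i <;> simp [matX, colHat, Fin.sum_univ_four]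
    · rw [Psi_y]
      fin_cases i <;> simp [matY, colHat, Fin.sum_univ_four]
    · rw [Psi_z]
      fin_cases i <;> simp [matZ, colHat, Fin.sum_univ_four]
  | algebraMap r =>
    simp [AlgHom.commutes, Matrix.algebraMap_matrix_apply, Algebra.commutes]
  | add s t _ _ hs ht =>
    simp only [map_add, Matrix.add_apply, add_mul, Finset.sum_add_distrib, hs, ht, mul_add]
  | mul s t _ _ hs ht =>
    simp only [map_mul, Matrix.mul_apply, Finset.sum_mul]
    rw [Finset.sum_comm]
    simp only [mul_assoc, ← Finset.mul_sum, ht]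
    simp only [← mul_assoc, ← Finset.sum_mul, hs]

/-- The coordinates of an element of `J(pr_5)` in the family `e_15, e_25, e_35`. -/
def coord (i : Fin 3) : UP k 5 →ₗ[k] UP k 5 where
  toFun u := Psi k u 0 i.succ
  map_add' u v := by simp
  map_smul' c u := by simp

theorem Psi_jgen (i : Fin 3) (l m : Fin 4) :
    Psi k (jgen k i) l m = if m = i.succ then colHat k l else 0 := by
  fin_cases i
  · change Psi k (UE k 0 4) l m = _
    rw [Psi_x]; fin_cases l <;> fin_cases m <;> simp [matX, colHat] 
  · change Psi k (UE k 1 4) l m = _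
    rw [Psi_y]; fin_cases l <;> fin_cases m <;> simp [matY, colHat] 
  · change Psi k (UE k 2 4) l m = _
    rw [Psi_z]; fin_cases l <;> fin_cases m <;> simp [matZ, colHat]

theorem coord_mul_jgen (p : UP k 5) (i j : Fin 3) :
    coord k j (p * jgen k i) = if j = i then p else 0 := by
  change Psi k (p * jgen k i) 0 j.succ = _
  rw [map_mul, Matrix.mul_apply]
  simp only [Psi_jgen, Fin.succ_inj]
  split_ifs with h
  · rw [Psi_colHat]; simp [colHat]
  · simp

/-- `J(pr_5)`, the kernel of `U(𝔭₅) → U(𝔭₄)`. -/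
def J : Submodule k (UP k 5) := LinearMap.ker (Upr5 k).toLinearMap

theorem mem_J {x : UP k 5} : x ∈ J k ↔ Upr5 k x = 0 := Iff.rfl

theorem J_mul_left {x : UP k 5} (a : UP k 5) (hx : x ∈ J k) : a * x ∈ J k := by
  rw [mem_J] at *; rw [map_mul, hx, mul_zero]

theorem J_mul_right {x : UP k 5} (a : UP k 5) (hx : x ∈ J k) : x * a ∈ J k := by
  rw [mem_J] at *; rw [map_mul, hx, zero_mul]

theorem Upr5_UE (i j : Fin 5) :
    Upr5 k (UE k i j) = UniversalEnvelopingAlgebra.ι k (tablePr5 k i j) := by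
  rw [Upr5, UE, mapU_ι, pr5, SphereBraid.lift_E]

theorem jgen_mem (i : Fin 3) : jgen k i ∈ J k := by
  rw [mem_J, jgen, Upr5_UE]
  fin_cases i <;> exact map_zero (UniversalEnvelopingAlgebra.ι k)

theorem ell_e0 : ell k (p4e0 k) = E k 1 2 := by
  have h : (p4EquivF2 k).toLieHom (p4e0 k) = f2e0 k := SphereBraid.lift_E _ (rel_tableP4F2 k) _ _
  rw [ell, LieHom.comp_apply, h]
  exact FreeLieAlgebra.lift_of_apply _ _

theorem ell_e1 : ell k (p4e1 k) = E k 0 1 := by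
  have h : (p4EquivF2 k).toLieHom (p4e1 k) = f2e1 k := SphereBraid.lift_E _ (rel_tableP4F2 k) _ _
  rw [ell, LieHom.comp_apply, h]
  exact FreeLieAlgebra.lift_of_apply _ _

theorem Psi_zero_col (u : UP k 5) (i : Fin 4) :
    Psi k u i 0 = if i = 0 then mapU (ell k) (Upr5 k u) else 0 := by
  have hu : u ∈ Algebra.adjoin k (fiveGen k) := by rw [adjoin_fiveGen]; trivial
  induction hu using Algebra.adjoin_induction generalizing i with
  | mem t ht =>
    simp only [fiveGen, Set.mem_insert_iff, Set.mem_singleton_iff] at ht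
    rcases ht with rfl | rfl | rfl | rfl | rfl
    · have h : mapU (ell k) (Upr5 k (UE k 0 1)) = UE k 0 1 := by
        rw [Upr5_UE, mapU_ι, UE, ← ell_e1]; rfl
      rw [h, Psi_a]
      fin_cases i <;> simp [matA]
    · have h : mapU (ell k) (Upr5 k (UE k 1 2)) = UE k 1 2 := by
        rw [Upr5_UE, mapU_ι, UE, ← ell_e0]; rfl
      rw [h, Psi_b]
      fin_cases i <;> simp [matB]
    · rw [show Upr5 k (UE k 0 4) = 0 from jgen_mem k 0, map_zero, Psi_x]
      fin_cases i <;> simp [matX]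
    · rw [show Upr5 k (UE k 1 4) = 0 from jgen_mem k 1, map_zero, Psi_y]
      fin_cases i <;> simp [matY]
    · rw [show Upr5 k (UE k 2 4) = 0 from jgen_mem k 2, map_zero, Psi_z]
      fin_cases i <;> simp [matZ]
  | algebraMap r =>
    simp [AlgHom.commutes, Matrix.algebraMap_matrix_apply]
  | add s t _ _ hs ht =>
    simp only [map_add, Matrix.add_apply, hs, ht]
    split_ifs <;> simp
  | mul s t _ _ hs ht =>
    simp only [map_mul, Matrix.mul_apply, ht, mul_ite, mul_zero, Finset.sum_ite_eq',
      Finset.mem_univ, if_true, hs]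
    split_ifs <;> simp

theorem eq_sum_coord {u : UP k 5} (hu : u ∈ J k) : u = ∑ i, coord k i u * jgen k i := by
  have h := Psi_colHat k u 0
  rw [Fin.sum_univ_succ, Psi_zero_col, (mem_J k).1 hu] at h
  simp only [map_zero, if_true, zero_mul, zero_add] at h
  have h0 : colHat k 0 = 1 := rfl
  rw [h0, one_mul] at h
  rw [← h]
  refine Finset.sum_congr rfl fun i _ => ?_
  rw [h]
  fin_cases i <;> rfl

theorem coord_mul_left (a : UP k 5) {u : UP k 5} (hu : u ∈ J k) (i : Fin 3) :
    coord k i (a * u) = a * coord k i u := by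
  conv_lhs => rw [eq_sum_coord k hu, Finset.mul_sum]
  simp only [← mul_assoc, map_sum, coord_mul_jgen]
  simp

theorem UE_mem_degP {m : ℕ} (i j : Fin m) : UE k i j ∈ degP k m 1 := by
  rw [degP, pow_one]; exact Submodule.subset_span ⟨i, j, rfl⟩

theorem one_mem_degP {m : ℕ} : (1 : UP k m) ∈ degP k m 0 := by
  rw [degP, pow_zero]; exact Submodule.one_le.1 le_rfl

theorem mul_mem_degP {m i j : ℕ} {s t : UP k m} (hs : s ∈ degP k m i) (ht : t ∈ degP k m j) :
    s * t ∈ degP k m (i + j) := by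
  rw [degP, pow_add]; exact Submodule.mul_mem_mul hs ht

/-- The degrees of the entries of the matrices `Psi u`. -/
theorem Psi_deg {n : ℕ} {u : UP k 5} (hu : u ∈ degP k 5 n) :
    (∀ i j : Fin 3, Psi k u i.succ j.succ ∈ degP k 5 n) ∧ Psi k u 0 0 ∈ degP k 5 n ∧
      (∀ j : Fin 3, ∀ m, n = m + 1 → Psi k u 0 j.succ ∈ degP k 5 m) ∧
      (∀ j : Fin 3, n = 0 → Psi k u 0 j.succ = 0) := by
  have hgen : ∀ t ∈ Submodule.span k {t | ∃ i j : Fin 5, t = UE k i j},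
      (∀ i j : Fin 3, Psi k t i.succ j.succ ∈ degP k 5 1) ∧ Psi k t 0 0 ∈ degP k 5 1 ∧
      (∀ j : Fin 3, Psi k t 0 j.succ ∈ degP k 5 0) := by
    intro t ht
    rw [span_fiveGen] at ht
    have da := UE_mem_degP k (0 : Fin 5) 1
    have db := UE_mem_degP k (1 : Fin 5) 2
    have dx := UE_mem_degP k (0 : Fin 5) 4
    have dy := UE_mem_degP k (1 : Fin 5) 4
    have dz := UE_mem_degP k (2 : Fin 5) 4
    have d1 := one_mem_degP k (m := 5)
    have d0 := (degP k 5 0).zero_mem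
    have d0' := (degP k 5 1).zero_mem
    induction ht using Submodule.span_induction with
    | mem t ht =>
      simp only [fiveGen, Set.mem_insert_iff, Set.mem_singleton_iff] at ht
      rcases ht with rfl | rfl | rfl | rfl | rfl
      · rw [Psi_a]
        refine ⟨fun i j => ?_, ?_, fun j => ?_⟩
        · fin_cases i <;> fin_cases j <;> simp [matA, add_mem, *]
        · simpa [matA] using da
        · fin_cases j <;> simp [matA]
      · rw [Psi_b]
        refine ⟨fun i j => ?_, ?_, fun j => ?_⟩
        · fin_cases i <;> fin_cases j <;> simp [matB, add_mem, *]
        · simpa [matB] using db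
        · fin_cases j <;> simp [matB]
      · rw [Psi_x]
        refine ⟨fun i j => ?_, ?_, fun j => ?_⟩
        · fin_cases i <;> fin_cases j <;> simp [matX, *]
        · simp [matX]
        · fin_cases j <;> simp [matX, d1]
      · rw [Psi_y]
        refine ⟨fun i j => ?_, ?_, fun j => ?_⟩
        · fin_cases i <;> fin_cases j <;> simp [matY, *]
        · simp [matY]
        · fin_cases j <;> simp [matY, d1]
      · rw [Psi_z]
        refine ⟨fun i j => ?_, ?_, fun j => ?_⟩
        · fin_cases i <;> fin_cases j <;> simp [matZ, *]
        · simp [matZ]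
        · fin_cases j <;> simp [matZ, d1]
    | zero => simp
    | add s t _ _ hs ht =>
      refine ⟨fun i j => ?_, ?_, fun j => ?_⟩
      · rw [map_add]; exact add_mem (hs.1 i j) (ht.1 i j)
      · rw [map_add]; exact add_mem hs.2.1 ht.2.1
      · rw [map_add]; exact add_mem (hs.2.2 j) (ht.2.2 j)
    | smul c s _ hs =>
      refine ⟨fun i j => ?_, ?_, fun j => ?_⟩
      · rw [map_smul]; exact Submodule.smul_mem _ c (hs.1 i j)
      · rw [map_smul]; exact Submodule.smul_mem _ c hs.2.1
      · rw [map_smul]; exact Submodule.smul_mem _ c (hs.2.2 j)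
  refine Submodule.pow_induction_on_right' (M := Submodule.span k {t | ∃ i j : Fin 5, t = UE k i j})
    (C := fun n u _ => (∀ i j : Fin 3, Psi k u i.succ j.succ ∈ degP k 5 n) ∧
      Psi k u 0 0 ∈ degP k 5 n ∧
      (∀ j : Fin 3, ∀ m, n = m + 1 → Psi k u 0 j.succ ∈ degP k 5 m) ∧
      (∀ j : Fin 3, n = 0 → Psi k u 0 j.succ = 0)) ?_ ?_ ?_ hu
  · intro r
    have hr : algebraMap k (UP k 5) r ∈ degP k 5 0 := by
      rw [Algebra.algebraMap_eq_smul_one]; exact Submodule.smul_mem _ _ (one_mem_degP k)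
    simp only [AlgHom.commutes, Matrix.algebraMap_matrix_apply]
    refine ⟨fun i j => ?_, by simpa using hr, fun j m h => by omega, fun j _ => ?_⟩
    · split_ifs
      · exact hr
      · exact zero_mem _
    · rw [if_neg (Fin.succ_ne_zero j).symm]
  · intro s t i _ _ hs ht
    refine ⟨fun i j => ?_, ?_, fun j m hm => ?_, fun j h0 => ?_⟩
    · rw [map_add]; exact add_mem (hs.1 i j) (ht.1 i j)
    · rw [map_add]; exact add_mem hs.2.1 ht.2.1
    · rw [map_add]; exact add_mem (hs.2.2.1 j m hm) (ht.2.2.1 j m hm)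
    · rw [map_add, Matrix.add_apply, hs.2.2.2 j h0, ht.2.2.2 j h0, add_zero]
  · intro n s _ hs t ht
    have hg := hgen t ht
    refine ⟨fun i j => ?_, ?_, fun j m hm => ?_, fun j h0 => by omega⟩
    · rw [map_mul, Matrix.mul_apply, Fin.sum_univ_succ, Psi_zero_col, if_neg (Fin.succ_ne_zero i),
        zero_mul, zero_add]
      exact sum_mem fun l _ => mul_mem_degP k (hs.1 i l) (hg.1 l j)
    · rw [map_mul, Matrix.mul_apply, Fin.sum_univ_succ]
      refine add_mem (mul_mem_degP k hs.2.1 hg.2.1) (sum_mem fun l _ => ?_)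
      rw [Psi_zero_col k t, if_neg (Fin.succ_ne_zero l), mul_zero]
      exact zero_mem _
    · obtain rfl : n = m := by omega
      rw [map_mul, Matrix.mul_apply, Fin.sum_univ_succ]
      refine add_mem (mul_mem_degP k hs.2.1 (hg.2.2 j)) (sum_mem fun l _ => ?_)
      rcases n with _ | n
      · rw [hs.2.2.2 l rfl, zero_mul]; exact zero_mem _
      · exact mul_mem_degP k (hs.2.2.1 l n rfl) (hg.1 l j)

theorem coord_deg {n : ℕ} {u : UP k 5} (hu : u ∈ degP k 5 (n + 1)) (i : Fin 3) :
    coord k i u ∈ degP k 5 n :=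
  (Psi_deg k hu).2.2.1 i n rfl

end Freeness


/-! ### The algebras `𝒲_l`, `𝒲_r` and the coproduct -/

section Coproduct

variable {k : Type u} [CommRing k]

/-- The algebra morphism out of `U(𝔣₂)` with given images of `e_0` and `e_1`. -/
def liftF2 {A : Type v} [Ring A] [Algebra k A] (a b : A) : UF2 k →ₐ[k] A :=
  UniversalEnvelopingAlgebra.lift k (FreeLieAlgebra.lift k ![a, b])

@[simp]
theorem liftF2_e0 {A : Type v} [Ring A] [Algebra k A] (a b : A) :
    liftF2 (k := k) a b (e0 k) = a := by
  rw [liftF2, e0, UniversalEnvelopingAlgebra.lift_ι_apply, f2e0, FreeLieAlgebra.lift_of_apply]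
  rfl

@[simp]
theorem liftF2_e1 {A : Type v} [Ring A] [Algebra k A] (a b : A) :
    liftF2 (k := k) a b (e1 k) = b := by
  rw [liftF2, e1, UniversalEnvelopingAlgebra.lift_ι_apply, f2e1, FreeLieAlgebra.lift_of_apply]
  rfl

theorem hom_ext_F2 {A : Type v} [Ring A] [Algebra k A] {F G : UF2 k →ₐ[k] A}
    (h0 : F (e0 k) = G (e0 k)) (h1 : F (e1 k) = G (e1 k)) : F = G := by
  apply UniversalEnvelopingAlgebra.hom_ext
  apply FreeLieAlgebra.hom_ext
  intro i
  fin_cases i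
  · exact h0
  · exact h1

theorem adjoin_F2 : Algebra.adjoin k {e0 k, e1 k} = ⊤ := by
  let S := Algebra.adjoin k {e0 k, e1 k}
  let a : S := ⟨e0 k, Algebra.subset_adjoin (by simp)⟩
  let b : S := ⟨e1 k, Algebra.subset_adjoin (by simp)⟩
  have hF : S.val.comp (liftF2 a b) = AlgHom.id k _ := hom_ext_F2 (by simp [a]) (by simp [b])
  rw [eq_top_iff]
  intro x _
  have h := DFunLike.congr_fun hF x
  have h2 : x = (liftF2 a b x : UF2 k) := h.symm
  rw [h2]
  exact (liftF2 a b x).2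

theorem e0_mem : e0 k ∈ degF2 k 1 := by
  rw [degF2, pow_one]; exact Submodule.subset_span (by simp)

theorem e1_mem : e1 k ∈ degF2 k 1 := by
  rw [degF2, pow_one]; exact Submodule.subset_span (by simp)

theorem one_mem_degF2 : (1 : UF2 k) ∈ degF2 k 0 := by
  rw [degF2, pow_zero]; exact Submodule.one_le.1 le_rfl

theorem mul_mem_degF2 {i j : ℕ} {s t : UF2 k} (hs : s ∈ degF2 k i) (ht : t ∈ degF2 k j) :
    s * t ∈ degF2 k (i + j) := by
  rw [degF2, pow_add]; exact Submodule.mul_mem_mul hs ht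

theorem degF2_induction {C : ℕ → UF2 k → Prop} (scalar : ∀ r : k, C 0 (algebraMap k _ r))
    (add : ∀ n x y, C n x → C n y → C n (x + y)) (smul : ∀ n (r : k) x, C n x → C n (r • x))
    (mul0 : ∀ n x, x ∈ degF2 k n → C n x → C (n + 1) (x * e0 k))
    (mul1 : ∀ n x, x ∈ degF2 k n → C n x → C (n + 1) (x * e1 k)) {n : ℕ} {x : UF2 k}
    (hx : x ∈ degF2 k n) : C n x := by
  refine Submodule.pow_induction_on_right' (M := Submodule.span k {e0 k, e1 k})
    (C := fun n x _ => C n x) scalar (fun x y i _ _ hx hy => add i x y hx hy) ?_ hx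
  intro i x hi hC m hm
  obtain ⟨r, s, rfl⟩ := Submodule.mem_span_pair.1 hm
  rw [mul_add, mul_smul_comm, mul_smul_comm]
  exact add _ _ _ (smul _ _ _ (mul0 i x hi hC)) (smul _ _ _ (mul1 i x hi hC))

/-- The counit of `U(𝔣₂)`. -/
def counitF2 : UF2 k →ₐ[k] k := liftF2 0 0

/-- Auxiliary morphism computing the quotient of right division by `e_1`. -/
def divMat : UF2 k →ₐ[k] Matrix (Fin 2) (Fin 2) (UF2 k) :=
  liftF2 !![e0 k, 0; 0, 0] !![e1 k, 1; 0, 0]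

theorem divMat_row (x : UF2 k) :
    divMat x 0 0 = x ∧ divMat x 1 0 = 0 ∧ divMat x 1 1 = algebraMap k _ (counitF2 x) := by
  have hx : x ∈ Algebra.adjoin k {e0 k, e1 k} := by rw [adjoin_F2]; trivial
  induction hx using Algebra.adjoin_induction with
  | mem t ht =>
    simp only [Set.mem_insert_iff, Set.mem_singleton_iff] at ht
    rcases ht with rfl | rfl <;> simp [divMat, counitF2]
  | algebraMap r => simp [AlgHom.commutes, Matrix.algebraMap_matrix_apply]
  | add s t _ _ hs ht => simp [hs, ht]
  | mul s t _ _ hs ht => simp [Matrix.mul_apply, Fin.sum_univ_two, hs, ht]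

/-- The linear map such that `1 ↦ 0`, `x e_0 ↦ 0` and `x e_1 ↦ x`. -/
def divE1 : UF2 k →ₗ[k] UF2 k where
  toFun x := divMat x 0 1
  map_add' x y := by simp
  map_smul' c x := by simp

theorem divE1_mul (x y : UF2 k) :
    divE1 (x * y) = x * divE1 y + counitF2 y • divE1 x := by
  change divMat (x * y) 0 1 = x * divMat y 0 1 + counitF2 y • divMat x 0 1
  rw [map_mul, Matrix.mul_apply, Fin.sum_univ_two, (divMat_row x).1, (divMat_row y).2.2,
    ← Algebra.commutes, ← Algebra.smul_def]

@[simp] theorem counitF2_e0 : counitF2 (e0 k) = 0 := by simp [counitF2]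
@[simp] theorem counitF2_e1 : counitF2 (e1 k) = 0 := by simp [counitF2]

@[simp] theorem divE1_e0 : divE1 (e0 k) = 0 := by
  change divMat (e0 k) 0 1 = 0
  simp [divMat]

@[simp] theorem divE1_e1 : divE1 (e1 k) = 1 := by
  change divMat (e1 k) 0 1 = 1
  simp [divMat]

@[simp] theorem divE1_algebraMap (r : k) : divE1 (algebraMap k (UF2 k) r) = 0 := by
  change divMat (algebraMap k (UF2 k) r) 0 1 = 0
  simp [AlgHom.commutes, Matrix.algebraMap_matrix_apply]

@[simp] theorem divE1_mul_e1 (x : UF2 k) : divE1 (x * e1 k) = x := by simp [divE1_mul]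

@[simp] theorem divE1_mul_e0 (x : UF2 k) : divE1 (x * e0 k) = 0 := by simp [divE1_mul]

theorem mul_e1_injective {x y : UF2 k} (h : x * e1 k = y * e1 k) : x = y := by
  rw [← divE1_mul_e1 x, h, divE1_mul_e1]

theorem divE1_deg {n : ℕ} {x : UF2 k} (hx : x ∈ degF2 k n) :
    (∀ m, n = m + 1 → divE1 x ∈ degF2 k m) ∧ (n = 0 → divE1 x = 0) := by
  refine degF2_induction (C := fun n x =>
    (∀ m, n = m + 1 → divE1 x ∈ degF2 k m) ∧ (n = 0 → divE1 x = 0)) ?_ ?_ ?_ ?_ ?_ hx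
  · exact fun r => ⟨fun m h => by omega, fun _ => divE1_algebraMap r⟩
  · refine fun n x y hx hy => ⟨fun m h => ?_, fun h => ?_⟩
    · rw [map_add]; exact add_mem (hx.1 m h) (hy.1 m h)
    · rw [map_add, hx.2 h, hy.2 h, add_zero]
  · refine fun n r x hx => ⟨fun m h => ?_, fun h => ?_⟩
    · rw [map_smul]; exact Submodule.smul_mem _ r (hx.1 m h)
    · rw [map_smul, hx.2 h, smul_zero]
  · refine fun n x hx _ => ⟨fun m h => ?_, fun h => by omega⟩
    rw [divE1_mul_e0]; exact zero_mem _
  · refine fun n x hx _ => ⟨fun m h => ?_, fun h => by omega⟩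
    obtain rfl : n = m := by omega
    rw [divE1_mul_e1]; exact hx

theorem counitF2_deg {n : ℕ} {x : UF2 k} (hx : x ∈ degF2 k (n + 1)) : counitF2 x = 0 := by
  have := degF2_induction (C := fun n x => ∀ m, n = m + 1 → counitF2 x = 0)
    (fun r m h => by omega) (fun n x y hx hy m h => by rw [map_add, hx m h, hy m h, add_zero])
    (fun n r x hx m h => by rw [map_smul, hx m h, smul_zero])
    (fun n x hx _ m h => by simp) (fun n x hx _ m h => by simp) hx
  exact this n rfl

variable (k)

/-- `𝒲_l = k1 ⊕ U(𝔣₂)e_1`. -/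
def Wl : Subalgebra k (UF2 k) where
  carrier := {w | ∃ (c : k) (a : UF2 k), w = algebraMap k _ c + a * e1 k}
  mul_mem' := by
    rintro _ _ ⟨c, a, rfl⟩ ⟨d, b, rfl⟩
    refine ⟨c * d, algebraMap k _ c * b + algebraMap k _ d * a + a * e1 k * b, ?_⟩
    have h : a * e1 k * algebraMap k _ d = algebraMap k _ d * (a * e1 k) :=
      (Algebra.commutes d _).symm
    rw [map_mul, add_mul, mul_add, mul_add, h]
    noncomm_ring
  add_mem' := by
    rintro _ _ ⟨c, a, rfl⟩ ⟨d, b, rfl⟩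
    exact ⟨c + d, a + b, by rw [map_add, add_mul]; abel⟩
  algebraMap_mem' r := ⟨r, 0, by simp⟩

/-- `𝒲_r = k1 ⊕ e_1U(𝔣₂)`. -/
def Wr : Subalgebra k (UF2 k) where
  carrier := {w | ∃ (c : k) (a : UF2 k), w = algebraMap k _ c + e1 k * a}
  mul_mem' := by
    rintro _ _ ⟨c, a, rfl⟩ ⟨d, b, rfl⟩
    refine ⟨c * d, algebraMap k _ c * b + algebraMap k _ d * a + a * e1 k * b, ?_⟩
    have h : e1 k * a * algebraMap k _ d = e1 k * (algebraMap k _ d * a) := by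
      rw [Algebra.commutes d a, mul_assoc]
    have h2 : algebraMap k _ c * (e1 k * b) = e1 k * (algebraMap k _ c * b) := by
      rw [← mul_assoc, Algebra.commutes, mul_assoc]
    rw [map_mul, add_mul, mul_add, mul_add, h, h2]
    noncomm_ring
  add_mem' := by
    rintro _ _ ⟨c, a, rfl⟩ ⟨d, b, rfl⟩
    exact ⟨c + d, a + b, by rw [map_add, mul_add]; abel⟩
  algebraMap_mem' r := ⟨r, 0, by simp⟩

/-- The grading of `𝒲_l` as a graded subalgebra of `U(𝔣₂)`. -/
def degWl (n : ℕ) : Submodule k (Wl k) := (degF2 k n).comap (Wl k).val.toLinearMap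

/-- The grading of `𝒲_r` as a graded subalgebra of `U(𝔣₂)`. -/
def degWr (n : ℕ) : Submodule k (Wr k) := (degF2 k n).comap (Wr k).val.toLinearMap

variable {k}

theorem Wl_eq (w : Wl k) :
    (w : UF2 k) = algebraMap k _ (counitF2 (w : UF2 k)) + divE1 (w : UF2 k) * e1 k := by
  obtain ⟨_, c, a, rfl⟩ := w
  simp

/-- The element `a e_1` of `𝒲_l`. -/
def WlMk (a : UF2 k) : Wl k := ⟨a * e1 k, 0, a, by simp⟩

/-- The element `e_1 a` of `𝒲_r`. -/
def WrMk (a : UF2 k) : Wr k := ⟨e1 k * a, 0, a, by simp⟩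

theorem exists_conj (w : Wl k) : ∃ z : Wr k, (z : UF2 k) * e1 k = e1 k * (w : UF2 k) := by
  obtain ⟨_, c, a, rfl⟩ := w
  refine ⟨⟨algebraMap k _ c + e1 k * a, c, a, rfl⟩, ?_⟩
  change (algebraMap k _ c + e1 k * a) * e1 k = e1 k * (algebraMap k _ c + a * e1 k)
  rw [add_mul, mul_add, Algebra.commutes, mul_assoc]

/-- `Ad(e_1) : 𝒲_l → 𝒲_r`: the value at `w` is the unique `z` with `z e_1 = e_1 w`. -/
def AdE1 : Wl k →ₐ[k] Wr k where
  toFun w := Classical.choose (exists_conj w)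
  map_one' := Subtype.ext (mul_e1_injective (by rw [Classical.choose_spec (exists_conj 1)]; simp))
  map_mul' w w' := Subtype.ext (mul_e1_injective (by
    rw [Classical.choose_spec (exists_conj (w * w')), MulMemClass.coe_mul, MulMemClass.coe_mul,
      mul_assoc, Classical.choose_spec (exists_conj w'), ← mul_assoc, ← mul_assoc,
      Classical.choose_spec (exists_conj w)]))
  map_zero' := Subtype.ext (mul_e1_injective (by rw [Classical.choose_spec (exists_conj 0)]; simp))
  map_add' w w' := Subtype.ext (mul_e1_injective (by
    rw [Classical.choose_spec (exists_conj (w + w')), AddMemClass.coe_add, AddMemClass.coe_add,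
      add_mul, Classical.choose_spec (exists_conj w'),
      Classical.choose_spec (exists_conj w), mul_add]))
  commutes' r := Subtype.ext (mul_e1_injective (by
    rw [Classical.choose_spec (exists_conj (algebraMap k _ r))]
    exact (Algebra.commutes r (e1 k)).symm))

theorem AdE1_spec (w : Wl k) : (AdE1 w : UF2 k) * e1 k = e1 k * (w : UF2 k) :=
  Classical.choose_spec (exists_conj w)

/-- `Ad(e_1)(a e_1) = e_1 a`. -/
theorem AdE1_WlMk (a : UF2 k) : AdE1 (WlMk a) = WrMk a :=
  Subtype.ext (mul_e1_injective (by
    rw [AdE1_spec]; exact (mul_assoc _ _ _).symm))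

theorem AdE1_deg (n : ℕ) (w : Wl k) (hw : w ∈ degWl k n) : AdE1 w ∈ degWr k n := by
  have h : (AdE1 w : UF2 k) = divE1 (e1 k * (w : UF2 k)) := by rw [← AdE1_spec, divE1_mul_e1]
  change (AdE1 w : UF2 k) ∈ degF2 k n
  rw [h]
  refine (divE1_deg (n := n + 1) ?_).1 n rfl
  rw [add_comm]
  exact mul_mem_degF2 e1_mem hw

/-! The isomorphism `k⟨Y⟩ ≃ 𝒲_l` and the coproduct `Δ_⋆`. -/

variable (k)

/-- `k⟨Y⟩`, the free algebra on `y_n`, `n ≥ 1`; the symbol `n : ℕ` stands for `y_{n+1}`. -/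
abbrev KY : Type u := FreeAlgebra k ℕ

/-- The generator `y_{n+1}` of `k⟨Y⟩`. -/
def Y (n : ℕ) : KY k := FreeAlgebra.ι k n

/-- The element `x_0^n x_1 = -e_0^n e_1` of `𝒲_l`. -/
def WlY (n : ℕ) : Wl k := WlMk (-(e0 k) ^ n)

/-- The morphism `k⟨Y⟩ → 𝒲_l`, `y_{n+1} ↦ x_0^n x_1`. -/
def kyToWl : KY k →ₐ[k] Wl k := FreeAlgebra.lift k (WlY k)

/-- The right action of `U(𝔣₂)` on `k⟨Y⟩[t] = k⟨Y⟩ ⊗ k[e_0]`. -/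
def wordAct : UF2 k →ₐ[k] (Module.End k (Polynomial (KY k)))ᵐᵒᵖ :=
  liftF2
    (MulOpposite.op (show Module.End k (Polynomial (KY k)) from
      { toFun := fun p => p * Polynomial.X
        map_add' := fun p q => add_mul p q _
        map_smul' := fun c p => smul_mul_assoc c p _ }))
    (MulOpposite.op (show Module.End k (Polynomial (KY k)) from
      { toFun := fun p => Polynomial.C (p.sum fun n c => -(c * Y k n))
        map_add' := fun p q => by
          rw [← map_add, Polynomial.sum_add_index]
          · intro i; simp
          · intro i a b; simp [add_mul, add_comm]
        map_smul' := fun c p => by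
          rw [Polynomial.sum_smul_index' _ _ _ (fun i => by simp), RingHom.id_apply,
            Polynomial.smul_C, Polynomial.sum_def, Polynomial.sum_def, Finset.smul_sum]
          simp }))

variable {k}

/-- The polynomial of `k⟨Y⟩[t]` attached to an element of `U(𝔣₂)`. -/
def toWord (x : UF2 k) : Polynomial (KY k) := (wordAct k x).unop 1

theorem toWord_add (x y : UF2 k) : toWord (x + y) = toWord x + toWord y := by
  simp [toWord]

theorem toWord_smul (c : k) (x : UF2 k) : toWord (c • x) = c • toWord x := by
  simp [toWord]

theorem toWord_algebraMap (c : k) : toWord (algebraMap k (UF2 k) c) = algebraMap k _ c := by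
  rw [toWord, AlgHom.commutes]
  change c • (1 : Polynomial (KY k)) = _
  rw [Algebra.algebraMap_eq_smul_one]

theorem toWord_mul_e0 (x : UF2 k) : toWord (x * e0 k) = toWord x * Polynomial.X := by
  simp [toWord, wordAct]

theorem toWord_mul_e1 (x : UF2 k) :
    toWord (x * e1 k) = Polynomial.C ((toWord x).sum fun n c => -(c * Y k n)) := by
  simp [toWord, wordAct]

theorem toWord_mul_e0_pow (x : UF2 k) (n : ℕ) :
    toWord (x * e0 k ^ n) = toWord x * Polynomial.X ^ n := by
  induction n with
  | zero => simp
  | succ n ih => rw [pow_succ, ← mul_assoc, toWord_mul_e0, ih, pow_succ, mul_assoc]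

theorem toWord_kyToWl (p : KY k) : toWord (kyToWl k p : UF2 k) = Polynomial.C p := by
  suffices h : ∀ (x : UF2 k) (c : KY k), toWord x = Polynomial.C c →
      toWord (x * (kyToWl k p : UF2 k)) = Polynomial.C (c * p) by
    simpa using h 1 1 (by simpa using toWord_algebraMap (k := k) 1)
  induction p using FreeAlgebra.induction with
  | grade0 r =>
    intro x c hx
    rw [AlgHom.commutes]
    change toWord (x * algebraMap k _ r) = _
    rw [← Algebra.commutes, ← Algebra.smul_def, toWord_smul, hx, ← Algebra.commutes,
      ← Algebra.smul_def, Polynomial.smul_C]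
  | grade1 n =>
    intro x c hx
    have h : (kyToWl k (FreeAlgebra.ι k n) : UF2 k) = -(e0 k) ^ n * e1 k := by
      rw [kyToWl, FreeAlgebra.lift_ι_apply]; rfl
    have h2 : x * (-(e0 k) ^ n * e1 k) = (-1 : k) • (x * e0 k ^ n * e1 k) := by
      rw [neg_smul, one_smul]; noncomm_ring
    rw [h, h2, toWord_smul, toWord_mul_e1, toWord_mul_e0_pow, hx, Polynomial.C_mul_X_pow_eq_monomial,
      Polynomial.sum_monomial_index _ _ (by simp)]
    simp [Y]
  | mul p q hp hq =>
    intro x c hx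
    rw [map_mul, MulMemClass.coe_mul, ← mul_assoc, hq _ _ (hp _ _ hx), mul_assoc]
  | add p q hp hq =>
    intro x c hx
    rw [map_add, AddMemClass.coe_add, mul_add, toWord_add, hp _ _ hx, hq _ _ hx, mul_add, map_add]

theorem kyToWl_injective : Function.Injective (kyToWl k) := by
  intro p q h
  have h2 := congrArg (fun w : Wl k => toWord (w : UF2 k)) h
  simp only [toWord_kyToWl] at h2
  exact Polynomial.C_injective h2

theorem kyToWl_surjective : Function.Surjective (kyToWl k) := by
  have span : ∀ x : UF2 k, x ∈ Submodule.span k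
      {t : UF2 k | ∃ (p : KY k) (n : ℕ), t = (kyToWl k p : UF2 k) * e0 k ^ n} := by
    set S := Submodule.span k
      {t : UF2 k | ∃ (p : KY k) (n : ℕ), t = (kyToWl k p : UF2 k) * e0 k ^ n} with hS
    have h0 : ∀ x ∈ S, x * e0 k ∈ S := by
      intro x hx
      induction hx using Submodule.span_induction with
      | mem t ht =>
        obtain ⟨p, n, rfl⟩ := ht
        exact Submodule.subset_span ⟨p, n + 1, by rw [pow_succ, mul_assoc]⟩
      | zero => simp
      | add s t _ _ hs ht => rw [add_mul]; exact add_mem hs ht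
      | smul c s _ hs => rw [smul_mul_assoc]; exact Submodule.smul_mem _ c hs
    have h1 : ∀ x ∈ S, x * e1 k ∈ S := by
      intro x hx
      induction hx using Submodule.span_induction with
      | mem t ht =>
        obtain ⟨p, n, rfl⟩ := ht
        refine Submodule.subset_span ⟨-(p * Y k n), 0, ?_⟩
        have h : (kyToWl k (Y k n) : UF2 k) = -(e0 k) ^ n * e1 k := by
          rw [kyToWl, Y, FreeAlgebra.lift_ι_apply]; rfl
        rw [map_neg, map_mul, NegMemClass.coe_neg, MulMemClass.coe_mul, h]
        noncomm_ring
      | zero => simp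
      | add s t _ _ hs ht => rw [add_mul]; exact add_mem hs ht
      | smul c s _ hs => rw [smul_mul_assoc]; exact Submodule.smul_mem _ c hs
    have hone : (1 : UF2 k) ∈ S := Submodule.subset_span ⟨1, 0, by simp⟩
    suffices h : ∀ x : UF2 k, ∀ y ∈ S, y * x ∈ S by
      intro x; simpa using h x 1 hone
    intro x
    have hx : x ∈ Algebra.adjoin k {e0 k, e1 k} := by rw [adjoin_F2]; trivial
    induction hx using Algebra.adjoin_induction with
    | mem t ht =>
      simp only [Set.mem_insert_iff, Set.mem_singleton_iff] at ht
      rcases ht with rfl | rfl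
      · exact h0
      · exact h1
    | algebraMap r =>
      intro y hy
      rw [← Algebra.commutes, ← Algebra.smul_def]; exact Submodule.smul_mem _ r hy
    | add s t _ _ hs ht => intro y hy; rw [mul_add]; exact add_mem (hs y hy) (ht y hy)
    | mul s t _ _ hs ht => intro y hy; rw [← mul_assoc]; exact ht _ (hs _ hy)
  have hmk : ∀ a : UF2 k, ∃ p, (kyToWl k p : UF2 k) = a * e1 k := by
    intro a
    induction span a using Submodule.span_induction with
    | mem t ht =>
      obtain ⟨p, n, rfl⟩ := ht
      refine ⟨-(p * Y k n), ?_⟩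
      have h : (kyToWl k (Y k n) : UF2 k) = -(e0 k) ^ n * e1 k := by
        rw [kyToWl, Y, FreeAlgebra.lift_ι_apply]; rfl
      rw [map_neg, map_mul, NegMemClass.coe_neg, MulMemClass.coe_mul, h]
      noncomm_ring
    | zero => exact ⟨0, by simp⟩
    | add s t _ _ hs ht =>
      obtain ⟨p, hp⟩ := hs
      obtain ⟨q, hq⟩ := ht
      exact ⟨p + q, by rw [map_add, AddMemClass.coe_add, hp, hq, add_mul]⟩
    | smul c s _ hs =>
      obtain ⟨p, hp⟩ := hs
      exact ⟨c • p, by rw [map_smul, SetLike.val_smul, hp, smul_mul_assoc]⟩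
  rintro ⟨_, c, a, rfl⟩
  obtain ⟨p, hp⟩ := hmk a
  refine ⟨algebraMap k _ c + p, Subtype.ext ?_⟩
  rw [map_add, AddMemClass.coe_add, hp, AlgHom.commutes]
  rfl

variable (k)

/-- The isomorphism `k⟨Y⟩ ≃ 𝒲_l`, `y_{n+1} ↦ x_0^n x_1`. -/
def kyEquivWl : KY k ≃ₐ[k] Wl k :=
  AlgEquiv.ofBijective (kyToWl k) ⟨kyToWl_injective, kyToWl_surjective⟩

/-- `Δ_⋆` on `k⟨Y⟩`: with `y_{n+1}` of index `n`,
`y_n ↦ y_n ⊗ 1 + 1 ⊗ y_n + ∑_{n' + n'' = n; n', n'' > 0} y_{n'} ⊗ y_{n''}`. -/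
def deltaKY : KY k →ₐ[k] KY k ⊗[k] KY k :=
  FreeAlgebra.lift k fun n =>
    Y k n ⊗ₜ[k] 1 + 1 ⊗ₜ[k] Y k n + ∑ i ∈ Finset.range n, Y k i ⊗ₜ[k] Y k (n - 1 - i)

/-- `Δ_⋆ : 𝒲_l → 𝒲_l^{⊗2}`, transported from `k⟨Y⟩`. -/
def deltaStar : Wl k →ₐ[k] Wl k ⊗[k] Wl k :=
  ((Algebra.TensorProduct.map (kyEquivWl k).toAlgHom (kyEquivWl k).toAlgHom).comp
    (deltaKY k)).comp (kyEquivWl k).symm.toAlgHom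

/-- `Δ_⋆^{l,r} = Ad(e_1)^{⊗2} ∘ Δ_⋆ : 𝒲_l → 𝒲_r^{⊗2}`. -/
def deltaLR : Wl k →ₐ[k] Wr k ⊗[k] Wr k :=
  (Algebra.TensorProduct.map AdE1 AdE1).comp (deltaStar k)

/-- `inc^{⊗2} : 𝒲_r^{⊗2} → U(𝔣₂)^{⊗2}`. -/
def incTensor : Wr k ⊗[k] Wr k →ₐ[k] UF2 k ⊗[k] UF2 k :=
  Algebra.TensorProduct.map (Wr k).val (Wr k).val

end Coproduct


/-! ### Degrees of the structure morphisms -/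

section Degrees

section General

variable {k : Type u} [CommRing k]
variable {A : Type v} [Ring A] [Algebra k A] {B : Type v'} [Ring B] [Algebra k B]
variable {𝒜 : ℕ → Submodule k A} {ℬ : ℕ → Submodule k B}

theorem tmul_mem_tensorDeg {i j n : ℕ} (h : i + j = n) {a : A} {b : B} (ha : a ∈ 𝒜 i)
    (hb : b ∈ ℬ j) : a ⊗ₜ[k] b ∈ tensorDeg 𝒜 ℬ n :=
  Submodule.mem_iSup_of_mem i (Submodule.mem_iSup_of_mem j (Submodule.mem_iSup_of_mem h
    (Submodule.apply_mem_map₂ (TensorProduct.mk k A B) ha hb)))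

theorem tensorDeg_le {n : ℕ} {S : Submodule k (A ⊗[k] B)}
    (h : ∀ i j, i + j = n → ∀ a ∈ 𝒜 i, ∀ b ∈ ℬ j, a ⊗ₜ[k] b ∈ S) : tensorDeg 𝒜 ℬ n ≤ S :=
  iSup_le fun i => iSup_le fun j => iSup_le fun hij => Submodule.map₂_le.2 fun a ha b hb =>
    h i j hij a ha b hb

theorem tensorDeg_mul (hA : ∀ i j s t, s ∈ 𝒜 i → t ∈ 𝒜 j → s * t ∈ 𝒜 (i + j))
    (hB : ∀ i j s t, s ∈ ℬ i → t ∈ ℬ j → s * t ∈ ℬ (i + j)) {m n : ℕ} {x y : A ⊗[k] B}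
    (hx : x ∈ tensorDeg 𝒜 ℬ m) (hy : y ∈ tensorDeg 𝒜 ℬ n) : x * y ∈ tensorDeg 𝒜 ℬ (m + n) := by
  have h1 : tensorDeg 𝒜 ℬ m ≤ (tensorDeg 𝒜 ℬ (m + n)).comap (LinearMap.mulRight k y) := by
    refine tensorDeg_le fun i j hij a ha b hb => ?_
    have h2 : tensorDeg 𝒜 ℬ n ≤
        (tensorDeg 𝒜 ℬ (m + n)).comap (LinearMap.mulLeft k (a ⊗ₜ[k] b)) := by
      refine tensorDeg_le fun i' j' hij' a' ha' b' hb' => ?_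
      change (a ⊗ₜ[k] b) * (a' ⊗ₜ[k] b') ∈ tensorDeg 𝒜 ℬ (m + n)
      rw [Algebra.TensorProduct.tmul_mul_tmul]
      exact tmul_mem_tensorDeg (by omega) (hA _ _ _ _ ha ha') (hB _ _ _ _ hb hb')
    exact h2 hy
  exact h1 hx

theorem pow_span_map (f : A →ₐ[k] B) (S : Set A) (h1 : (1 : B) ∈ ℬ 0)
    (hmul : ∀ i j s t, s ∈ ℬ i → t ∈ ℬ j → s * t ∈ ℬ (i + j)) (hS : ∀ s ∈ S, f s ∈ ℬ 1)
    (n : ℕ) (a : A) (ha : a ∈ (Submodule.span k S) ^ n) : f a ∈ ℬ n := by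
  have hspan : Submodule.span k S ≤ (ℬ 1).comap f.toLinearMap := Submodule.span_le.2 hS
  refine Submodule.pow_induction_on_right' (M := Submodule.span k S)
    (C := fun n a _ => f a ∈ ℬ n) ?_ ?_ ?_ ha
  · intro r
    rw [AlgHom.commutes, Algebra.algebraMap_eq_smul_one]
    exact Submodule.smul_mem _ r h1
  · intro x y i _ _ hx hy
    rw [map_add]; exact add_mem hx hy
  · intro i x _ hx m hm
    rw [map_mul]; exact hmul _ _ _ _ hx (hspan hm)

end General

variable (k : Type u) [CommRing k]

/-- The grading of `U(𝔣₂)^{⊗2}`. -/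
abbrev degFF : ℕ → Submodule k (UF2 k ⊗[k] UF2 k) := tensorDeg (degF2 k) (degF2 k)

/-- The grading of `𝒲_r^{⊗2}`. -/
abbrev degWW : ℕ → Submodule k (Wr k ⊗[k] Wr k) := tensorDeg (degWr k) (degWr k)

theorem one_mem_degFF : (1 : UF2 k ⊗[k] UF2 k) ∈ degFF k 0 :=
  tmul_mem_tensorDeg (add_zero 0) one_mem_degF2 one_mem_degF2

theorem mul_mem_degFF (i j : ℕ) (s t : UF2 k ⊗[k] UF2 k) (hs : s ∈ degFF k i)
    (ht : t ∈ degFF k j) : s * t ∈ degFF k (i + j) :=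
  tensorDeg_mul (fun _ _ _ _ => mul_mem_degF2) (fun _ _ _ _ => mul_mem_degF2) hs ht

theorem one_mem_degWW : (1 : Wr k ⊗[k] Wr k) ∈ degWW k 0 :=
  tmul_mem_tensorDeg (add_zero 0) (show (1 : UF2 k) ∈ degF2 k 0 from one_mem_degF2)
    (show (1 : UF2 k) ∈ degF2 k 0 from one_mem_degF2)

theorem mul_mem_degWr (i j : ℕ) (s t : Wr k) (hs : s ∈ degWr k i) (ht : t ∈ degWr k j) :
    s * t ∈ degWr k (i + j) :=
  show (s : UF2 k) * (t : UF2 k) ∈ degF2 k (i + j) from mul_mem_degF2 hs ht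

theorem mul_mem_degWW (i j : ℕ) (s t : Wr k ⊗[k] Wr k) (hs : s ∈ degWW k i)
    (ht : t ∈ degWW k j) : s * t ∈ degWW k (i + j) :=
  tensorDeg_mul (mul_mem_degWr k) (mul_mem_degWr k) hs ht

theorem incTensor_deg (n : ℕ) (x : Wr k ⊗[k] Wr k) (hx : x ∈ degWW k n) :
    incTensor k x ∈ degFF k n := by
  have h : degWW k n ≤ (degFF k n).comap (incTensor k).toLinearMap :=
    tensorDeg_le fun i j hij a ha b hb => tmul_mem_tensorDeg hij ha hb
  exact h hx

/-- Elements of `k⟨Y⟩[t]` of total degree `n`, where `t` has degree `1` and `y_i` has degree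
`i`. -/
def wordDeg (n : ℕ) : Submodule k (Polynomial (KY k)) :=
  Submodule.span k {f | ∃ (l : List ℕ) (m : ℕ), (l.map Nat.succ).sum + m = n ∧
    f = Polynomial.monomial m (l.map (Y k)).prod}

theorem toWord_deg {n : ℕ} {x : UF2 k} (hx : x ∈ degF2 k n) : toWord x ∈ wordDeg k n := by
  refine degF2_induction (C := fun n x => toWord x ∈ wordDeg k n) ?_ ?_ ?_ ?_ ?_ hx
  · intro r
    rw [toWord_algebraMap, Algebra.algebraMap_eq_smul_one]
    exact Submodule.smul_mem _ _ (Submodule.subset_span ⟨[], 0, by simp, by simp⟩)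
  · intro n x y hx hy
    rw [toWord_add]; exact add_mem hx hy
  · intro n r x hx
    rw [toWord_smul]; exact Submodule.smul_mem _ r hx
  · intro n x _ hx
    rw [toWord_mul_e0]
    have h : wordDeg k n ≤ (wordDeg k (n + 1)).comap (LinearMap.mulRight k Polynomial.X) := by
      refine Submodule.span_le.2 ?_
      rintro _ ⟨l, m, h, rfl⟩
      refine Submodule.subset_span ⟨l, m + 1, by omega, ?_⟩
      simp [Polynomial.monomial_mul_X]
    exact h hx
  · intro n x _ hx
    rw [toWord_mul_e1]
    have e : ∀ p : Polynomial (KY k), (wordAct k (e1 k)).unop p =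
        Polynomial.C (p.sum fun n c => -(c * Y k n)) := by
      intro p; simp [wordAct]
    rw [← e]
    have h : wordDeg k n ≤ (wordDeg k (n + 1)).comap (wordAct k (e1 k)).unop := by
      refine Submodule.span_le.2 ?_
      rintro _ ⟨l, m, h, rfl⟩
      change (wordAct k (e1 k)).unop _ ∈ wordDeg k (n + 1)
      rw [e, Polynomial.sum_monomial_index _ _ (by simp), map_neg]
      refine neg_mem (Submodule.subset_span ⟨l ++ [m], 0, ?_, ?_⟩)
      · simp; omega
      · simp [Polynomial.monomial_zero_left]
    exact h hx

theorem deltaLR_deg (n : ℕ) (w : Wl k) (hw : w ∈ degWl k n) : deltaLR k w ∈ degWW k n := by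
  let F : KY k →ₐ[k] Wr k ⊗[k] Wr k := (Algebra.TensorProduct.map AdE1 AdE1).comp
    ((Algebra.TensorProduct.map (kyEquivWl k).toAlgHom (kyEquivWl k).toAlgHom).comp (deltaKY k))
  obtain ⟨p, rfl⟩ := (kyEquivWl k).surjective w
  have hF : deltaLR k (kyEquivWl k p) = F p := by
    change F ((kyEquivWl k).symm (kyEquivWl k p)) = F p
    rw [AlgEquiv.symm_apply_apply]
  rw [hF]
  have hY : ∀ i, AdE1 (kyEquivWl k (Y k i)) ∈ degWr k (i + 1) := by
    intro i
    refine AdE1_deg _ _ ?_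
    have h : kyEquivWl k (Y k i) = WlY k i := FreeAlgebra.lift_ι_apply _ _
    rw [h]
    change -(e0 k) ^ i * e1 k ∈ degF2 k (i + 1)
    refine mul_mem_degF2 (neg_mem ?_) e1_mem
    induction i with
    | zero => rw [pow_zero]; exact one_mem_degF2
    | succ i ih => rw [pow_succ]; exact mul_mem_degF2 (ih (FreeAlgebra.lift_ι_apply _ _)) e0_mem
  have h1 : (1 : Wr k) ∈ degWr k 0 := show (1 : UF2 k) ∈ degF2 k 0 from one_mem_degF2
  have hFY : ∀ i, F (Y k i) ∈ degWW k (i + 1) := by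
    intro i
    have h : deltaKY k (Y k i) = Y k i ⊗ₜ[k] 1 + 1 ⊗ₜ[k] Y k i +
      ∑ j ∈ Finset.range i, Y k j ⊗ₜ[k] Y k (i - 1 - j) := FreeAlgebra.lift_ι_apply _ _
    simp only [F, AlgHom.comp_apply, h, map_add, map_sum, Algebra.TensorProduct.map_tmul, map_one]
    refine add_mem (add_mem ?_ ?_) (sum_mem fun j hj => ?_)
    · exact tmul_mem_tensorDeg (add_zero _) (hY i) h1
    · exact tmul_mem_tensorDeg (zero_add _) h1 (hY i)
    · have := Finset.mem_range.1 hj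
      exact tmul_mem_tensorDeg (by omega) (hY j) (hY (i - 1 - j))
  have hword : ∀ l : List ℕ, F (l.map (Y k)).prod ∈ degWW k (l.map Nat.succ).sum := by
    intro l
    induction l with
    | nil => simpa using one_mem_degWW k
    | cons i l ih =>
      rw [List.map_cons, List.map_cons, List.prod_cons, map_mul, List.sum_cons]
      exact mul_mem_degWW k _ _ _ _ (hFY i) ih
  have hw2 : Polynomial.C p ∈ wordDeg k n := by
    rw [← toWord_kyToWl]; exact toWord_deg k hw
  have hle : wordDeg k n ≤ (degWW k n).comap
      (F.toLinearMap ∘ₗ ((Polynomial.lcoeff (KY k) 0).restrictScalars k)) := by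
    refine Submodule.span_le.2 ?_
    rintro _ ⟨l, m, h, rfl⟩
    change F ((Polynomial.monomial m (l.map (Y k)).prod).coeff 0) ∈ degWW k n
    rw [Polynomial.coeff_monomial]
    split_ifs with hm
    · subst hm; rw [← h]; exact hword l
    · rw [map_zero]; exact zero_mem _
  have := hle hw2
  change F ((Polynomial.C p).coeff 0) ∈ degWW k n at this
  rwa [Polynomial.coeff_C_zero] at this

variable [Algebra ℚ k]

theorem p4EquivF2_e0 : p4EquivF2 k (p4e0 k) = f2e0 k := SphereBraid.lift_E _ (rel_tableP4F2 k) _ _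

theorem p4EquivF2_e1 : p4EquivF2 k (p4e1 k) = f2e1 k := SphereBraid.lift_E _ (rel_tableP4F2 k) _ _

theorem Upr1_UE (i j : Fin 5) : Upr1 k (UE k i j) =
    UniversalEnvelopingAlgebra.ι k (p4EquivF2 k (tablePr1 k i j)) := by
  rw [Upr1, UE, mapU_ι, LieHom.comp_apply, pr1, SphereBraid.lift_E]; rfl

theorem Upr2_UE (i j : Fin 5) : Upr2 k (UE k i j) =
    UniversalEnvelopingAlgebra.ι k (p4EquivF2 k (tablePr2 k i j)) := by
  rw [Upr2, UE, mapU_ι, LieHom.comp_apply, pr2, SphereBraid.lift_E]; rfl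

theorem ι_zero : UniversalEnvelopingAlgebra.ι k (p4EquivF2 k 0) = 0 := by simp

theorem ι_p4e0 : UniversalEnvelopingAlgebra.ι k (p4EquivF2 k (p4e0 k)) = e0 k := by
  rw [p4EquivF2_e0]; rfl

theorem ι_p4e1 : UniversalEnvelopingAlgebra.ι k (p4EquivF2 k (p4e1 k)) = e1 k := by
  rw [p4EquivF2_e1]; rfl

theorem ι_p4einf :
    UniversalEnvelopingAlgebra.ι k (p4EquivF2 k (p4einf k)) = -e0 k - e1 k := by
  rw [p4einf, map_sub, map_neg, map_sub, map_neg, ι_p4e0, ι_p4e1]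

theorem Upr12_UE (i j : Fin 5) : Upr12 k (UE k i j) =
    UniversalEnvelopingAlgebra.ι k (p4EquivF2 k (tablePr1 k i j)) ⊗ₜ[k] 1 +
      1 ⊗ₜ[k] UniversalEnvelopingAlgebra.ι k (p4EquivF2 k (tablePr2 k i j)) := by
  rw [← Upr1_UE, ← Upr2_UE, Upr12, UE, UniversalEnvelopingAlgebra.lift_ι_apply]; rfl

theorem Upr12_a : Upr12 k (UE k 0 1) = 0 := by
  rw [Upr12_UE, show tablePr1 k 0 1 = 0 from rfl, show tablePr2 k 0 1 = 0 from rfl, ι_zero]; simp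

theorem Upr12_b : Upr12 k (UE k 1 2) = e0 k ⊗ₜ[k] 1 := by
  rw [Upr12_UE, show tablePr1 k 1 2 = p4e0 k from rfl, show tablePr2 k 1 2 = 0 from rfl, ι_zero,
    ι_p4e0]; simp

theorem Upr12_x : Upr12 k (UE k 0 4) = 1 ⊗ₜ[k] e1 k := by
  rw [Upr12_UE, show tablePr1 k 0 4 = 0 from rfl, show tablePr2 k 0 4 = p4e1 k from rfl, ι_zero,
    ι_p4e1]; simp

theorem Upr12_y : Upr12 k (UE k 1 4) = e1 k ⊗ₜ[k] 1 := by
  rw [Upr12_UE, show tablePr1 k 1 4 = p4e1 k from rfl, show tablePr2 k 1 4 = 0 from rfl, ι_zero,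
    ι_p4e1]; simp

theorem Upr12_z :
    Upr12 k (UE k 2 4) = (-e0 k - e1 k) ⊗ₜ[k] 1 + 1 ⊗ₜ[k] e0 k := by
  rw [Upr12_UE, show tablePr1 k 2 4 = p4einf k from rfl, show tablePr2 k 2 4 = p4e0 k from rfl,
    ι_p4e0, ι_p4einf]

theorem Upr12_deg (n : ℕ) (a : UP k 5) (ha : a ∈ degP k 5 n) : Upr12 k a ∈ degFF k n := by
  have hl : ∀ t ∈ degF2 k 1, t ⊗ₜ[k] (1 : UF2 k) ∈ degFF k 1 := fun t ht =>
    tmul_mem_tensorDeg (add_zero 1) ht one_mem_degF2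
  have hr : ∀ t ∈ degF2 k 1, (1 : UF2 k) ⊗ₜ[k] t ∈ degFF k 1 := fun t ht =>
    tmul_mem_tensorDeg (zero_add 1) one_mem_degF2 ht
  rw [degP, span_fiveGen] at ha
  refine pow_span_map (Upr12 k) _ (one_mem_degFF k) (mul_mem_degFF k) ?_ n a ha
  intro s hs
  simp only [fiveGen, Set.mem_insert_iff, Set.mem_singleton_iff] at hs
  rcases hs with rfl | rfl | rfl | rfl | rfl
  · rw [Upr12_a]; exact zero_mem _
  · rw [Upr12_b]; exact hl _ e0_mem
  · rw [Upr12_x]; exact hr _ e1_mem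
  · rw [Upr12_y]; exact hl _ e1_mem
  · rw [Upr12_z]; exact add_mem (hl _ (sub_mem (neg_mem e0_mem) e1_mem)) (hr _ e0_mem)

theorem Uell_e0 : Uell k (e0 k) = UE k 1 2 := by
  rw [Uell, e0, mapU_ι, LieHom.comp_apply, UE, ← ell_e0, ← p4EquivF2_e0]
  congr 2
  exact (p4EquivF2 k).symm_apply_apply (p4e0 k)

theorem Uell_e1 : Uell k (e1 k) = UE k 0 1 := by
  rw [Uell, e1, mapU_ι, LieHom.comp_apply, UE, ← ell_e1, ← p4EquivF2_e1]
  congr 2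
  exact (p4EquivF2 k).symm_apply_apply (p4e1 k)

theorem Uell_deg (n : ℕ) (a : UF2 k) (ha : a ∈ degF2 k n) : Uell k a ∈ degP k 5 n := by
  refine pow_span_map (Uell k) {e0 k, e1 k} (one_mem_degP k)
    (fun _ _ _ _ => mul_mem_degP k) ?_ n a ha
  intro s hs
  simp only [Set.mem_insert_iff, Set.mem_singleton_iff] at hs
  rcases hs with rfl | rfl
  · rw [Uell_e0]; exact UE_mem_degP k _ _
  · rw [Uell_e1]; exact UE_mem_degP k _ _

end Degrees


/-! ### The category of quadruples and the functors -/

section Functors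

variable (k : Type u) [CommRing k]

/-- Quadruples `(V, W, α, β)` with `V` a graded `U(𝔣₂)`-module, `W` a graded `k`-module, `α` and
`β` linear of degrees `1` and `0`, and `β ∘ α` the action of `e_1` on `V`. -/
structure Quad where
  V : GrMod.{u, u, w} (degF2 k)
  W : GrMod.{u, u, w} (baseDeg k)
  α : V.carrier →ₗ[k] W.carrier
  β : W.carrier →ₗ[k] V.carrier
  α_deg : ∀ {n : ℕ} {v : V.carrier}, v ∈ V.deg n → α v ∈ W.deg (n + 1)
  β_deg : ∀ {n : ℕ} {x : W.carrier}, x ∈ W.deg n → β x ∈ V.deg n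
  β_comp_α : β ∘ₗ α = V.act (e1 k)

namespace Quad

variable {k}

/-- Morphisms of quadruples. -/
@[ext]
structure Hom (Q Q' : Quad.{u, w} k) where
  f : Q.V ⟶ Q'.V
  g : Q.W ⟶ Q'.W
  comm_α : ∀ v : Q.V.carrier, g.toLin (Q.α v) = Q'.α (f.toLin v)
  comm_β : ∀ x : Q.W.carrier, f.toLin (Q.β x) = Q'.β (g.toLin x)

instance category : Category (Quad.{u, w} k) where
  Hom := Hom
  id Q := ⟨𝟙 Q.V, 𝟙 Q.W, fun _ => rfl, fun _ => rfl⟩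
  comp F G := ⟨F.f ≫ G.f, F.g ≫ G.g,
    fun v => (congrArg G.g.toLin (F.comm_α v)).trans (G.comm_α (F.f.toLin v)),
    fun x => (congrArg G.f.toLin (F.comm_β x)).trans (G.comm_β (F.g.toLin x))⟩

variable (k) in
/-- Quadruples such that `V` and `W` have finite support. -/
def IsFin : ObjectProperty (Quad.{u, w} k) :=
  fun Q => GrMod.IsFin (degF2 k) Q.V ∧ GrMod.IsFin (baseDeg k) Q.W

/-- The action of `𝒲_l` on `W`: `1` acts as the identity and `x e_1` as `α ∘ x ∘ β`. -/
def actW (Q : Quad.{u, w} k) : Wl k →ₐ[k] Module.End k Q.W.carrier :=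
  AlgHom.ofLinearMap
    { toFun := fun w => counitF2 (w : UF2 k) • (1 : Module.End k Q.W.carrier) +
        Q.α ∘ₗ Q.V.act (divE1 (w : UF2 k)) ∘ₗ Q.β
      map_add' := fun w w' => by
        ext x; simp [add_smul]; abel
      map_smul' := fun c w => by
        ext x; simp [mul_smul] }
    (by
      ext x
      have h : divE1 (1 : UF2 k) = 0 := by simpa using divE1_algebraMap (k := k) 1
      simp [h])
    (by
      intro w w'
      have hβα : ∀ v, Q.β (Q.α v) = Q.V.act (e1 k) v := fun v => DFunLike.congr_fun Q.β_comp_α v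
      have hw : Q.V.act (w : UF2 k) = counitF2 (w : UF2 k) • (1 : Module.End k Q.V.carrier) +
          Q.V.act (divE1 (w : UF2 k)) * Q.V.act (e1 k) := by
        conv_lhs => rw [Wl_eq w, map_add, map_mul, AlgHom.commutes, Algebra.algebraMap_eq_smul_one]
      ext x
      simp [divE1_mul, hβα, hw, mul_smul, add_smul]
      abel)

theorem actW_WlMk (Q : Quad.{u, w} k) (x : UF2 k) :
    Q.actW (WlMk x) = Q.α ∘ₗ Q.V.act x ∘ₗ Q.β := by
  have h1 : counitF2 ((WlMk x : Wl k) : UF2 k) = 0 := by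
    change counitF2 (x * e1 k) = 0; simp
  have h2 : divE1 ((WlMk x : Wl k) : UF2 k) = x := divE1_mul_e1 x
  change counitF2 ((WlMk x : Wl k) : UF2 k) • (1 : Module.End k Q.W.carrier) +
        Q.α ∘ₗ Q.V.act (divE1 ((WlMk x : Wl k) : UF2 k)) ∘ₗ Q.β = _
  rw [h1, h2, zero_smul, zero_add]

theorem actW_deg (Q : Quad.{u, w} k) {i j : ℕ} {w : Wl k} {x : Q.W.carrier}
    (hw : w ∈ degWl k i) (hx : x ∈ Q.W.deg j) : Q.actW w x ∈ Q.W.deg (i + j) := by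
  change counitF2 (w : UF2 k) • x + Q.α (Q.V.act (divE1 (w : UF2 k)) (Q.β x)) ∈ Q.W.deg (i + j)
  have hw : (w : UF2 k) ∈ degF2 k i := hw
  rcases i with _ | i
  · rw [(divE1_deg hw).2 rfl, map_zero, LinearMap.zero_apply, map_zero, add_zero, zero_add]
    exact Submodule.smul_mem _ _ hx
  · rw [counitF2_deg hw, zero_smul, zero_add, show i + 1 + j = i + j + 1 by omega]
    exact Q.α_deg (Q.V.act_mem ((divE1_deg hw).1 i rfl) (Q.β_deg hx))

end Quad

/-- The full subcategory of quadruples with finite support. -/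
abbrev QuadFin := (Quad.IsFin.{u, w} k).FullSubcategory

/-- The functor `F_QW : Quad ⥤ GrMod(𝒲_l)`. -/
def FQW : Quad.{u, w} k ⥤ GrMod.{u, u, w} (degWl k) where
  obj Q :=
    { carrier := Q.W.carrier
      act := Q.actW
      deg := Q.W.deg
      isInternal := Q.W.isInternal
      act_mem := Q.actW_deg }
  map {Q Q'} φ :=
    { toLin := φ.g.toLin
      map_act := fun w x => by
        change φ.g.toLin (counitF2 (w : UF2 k) • x + Q.α (Q.V.act (divE1 (w : UF2 k)) (Q.β x))) =
          counitF2 (w : UF2 k) • φ.g.toLin x +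
            Q'.α (Q'.V.act (divE1 (w : UF2 k)) (Q'.β (φ.g.toLin x)))
        rw [map_add, map_smul, φ.comm_α, φ.f.map_act, φ.comm_β]
      map_deg := fun h => φ.g.map_deg h }

variable [Algebra ℚ k]

/-! The endofunctor `N ↦ Hom_{U(𝔭₅)}(J(pr_5), N)`. -/

section HomJ

variable {k}

/-- The `U(𝔭₅)`-linear maps `J(pr_5) → N`. -/
def homJ (N : GrMod.{u, u, w} (degP k 5)) : Submodule k (J k →ₗ[k] N.carrier) where
  carrier := {φ | ∀ (a : UP k 5) (x : J k),
    φ ⟨a * (x : UP k 5), J_mul_left k a x.2⟩ = N.act a (φ x)}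
  add_mem' := fun hφ hψ a x => by simp [hφ a x, hψ a x]
  zero_mem' := fun a x => by simp
  smul_mem' := fun c φ hφ a x => by simp [hφ a x]

variable (k) in
/-- Right multiplication by `b` on `J(pr_5)`. -/
def rightMulJ (b : UP k 5) : J k →ₗ[k] J k where
  toFun x := ⟨(x : UP k 5) * b, J_mul_right k b x.2⟩
  map_add' x y := Subtype.ext (add_mul _ _ _)
  map_smul' c x := Subtype.ext (smul_mul_assoc _ _ _)

/-- The left action of `U(𝔭₅)` on `Hom_{U(𝔭₅)}(J(pr_5), N)`: `(b φ)(x) = φ(x b)`. -/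
def homJAct (N : GrMod.{u, u, w} (degP k 5)) : UP k 5 →ₐ[k] Module.End k (homJ N) :=
  AlgHom.ofLinearMap
    { toFun := fun b =>
        { toFun := fun φ => ⟨φ.1 ∘ₗ rightMulJ k b, fun a x => by
            have h := φ.2 a (rightMulJ k b x)
            rw [LinearMap.comp_apply, LinearMap.comp_apply, ← h]
            exact congrArg φ.1 (Subtype.ext (mul_assoc _ _ _))⟩
          map_add' := fun φ ψ => rfl
          map_smul' := fun c φ => rfl }
      map_add' := fun b c => by
        ext φ x
        change φ.1 (rightMulJ k (b + c) x) = φ.1 (rightMulJ k b x) + φ.1 (rightMulJ k c x)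
        rw [← map_add]
        exact congrArg φ.1 (Subtype.ext (mul_add _ _ _))
      map_smul' := fun c b => by
        ext φ x
        change φ.1 (rightMulJ k (c • b) x) = c • φ.1 (rightMulJ k b x)
        rw [← map_smul]
        exact congrArg φ.1 (Subtype.ext (mul_smul_comm _ _ _)) }
    (by
      ext φ x
      change φ.1 (rightMulJ k 1 x) = φ.1 x
      exact congrArg φ.1 (Subtype.ext (mul_one _)))
    (by
      intro b c
      ext φ x
      change φ.1 (rightMulJ k (b * c) x) = φ.1 (rightMulJ k c (rightMulJ k b x))
      exact congrArg φ.1 (Subtype.ext (mul_assoc _ _ _).symm))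

/-- The grading of `Hom_{U(𝔭₅)}(J(pr_5), N)`, normalized by giving the generators `e_15`, `e_25`,
`e_35` of `J(pr_5)` degree `0`: `φ` has degree `n` if it maps the part of `J(pr_5)` of degree
`m + 1` in `U(𝔭₅)` to the part of `N` of degree `n + m`. -/
def homJDeg (N : GrMod.{u, u, w} (degP k 5)) (n : ℕ) : Submodule k (homJ N) where
  carrier := {φ | ∀ (m : ℕ) (x : J k), (x : UP k 5) ∈ degP k 5 (m + 1) → φ.1 x ∈ N.deg (n + m)}
  add_mem' := fun hφ hψ m x hx => add_mem (hφ m x hx) (hψ m x hx)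
  zero_mem' := fun m x hx => zero_mem _
  smul_mem' := fun c φ hφ m x hx => Submodule.smul_mem _ c (hφ m x hx)

variable (k) in
/-- The generators `e_15, e_25, e_35` as elements of `J(pr_5)`. -/
def jgenJ (i : Fin 3) : J k := ⟨jgen k i, jgen_mem k i⟩

/-- The evaluation isomorphism `φ ↦ (φ(e_15), φ(e_25), φ(e_35))`. -/
def evEquiv (N : GrMod.{u, u, w} (degP k 5)) : homJ N ≃ₗ[k] (Fin 3 → N.carrier) where
  toFun φ i := φ.1 (jgenJ k i)
  map_add' φ ψ := rfl
  map_smul' c φ := rfl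
  invFun v :=
    ⟨{ toFun := fun x => ∑ i, N.act (coord k i (x : UP k 5)) (v i)
       map_add' := fun x y => by simp [Finset.sum_add_distrib]
       map_smul' := fun c x => by simp [Finset.smul_sum] },
     fun a x => by
      simp only [LinearMap.coe_mk, AddHom.coe_mk, coord_mul_left k a x.2, map_mul, map_sum,
        Module.End.mul_apply]⟩
  left_inv φ := by
    ext x
    change ∑ i, N.act (coord k i (x : UP k 5)) (φ.1 (jgenJ k i)) = φ.1 x
    have hx : x = ∑ i, (⟨coord k i (x : UP k 5) * jgen k i, J_mul_left k _ (jgen_mem k i)⟩ : J k) :=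
      Subtype.ext (by rw [AddSubmonoidClass.coe_finsetSum]; exact eq_sum_coord k x.2)
    conv_rhs => rw [hx, map_sum]
    exact Finset.sum_congr rfl fun i _ => (φ.2 _ (jgenJ k i)).symm
  right_inv v := by
    funext j
    change ∑ i, N.act (coord k i (jgen k j)) (v i) = v j
    have h : ∀ i, coord k i (jgen k j) = if i = j then 1 else 0 := fun i => by
      rw [← coord_mul_jgen, one_mul]
    rw [Finset.sum_eq_single j]
    · rw [h, if_pos rfl, map_one]; rfl
    · intro i _ hij; rw [h, if_neg hij, map_zero]; rfl
    · simp

theorem evEquiv_symm_apply (N : GrMod.{u, u, w} (degP k 5)) (v : Fin 3 → N.carrier) (x : J k) :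
    ((evEquiv N).symm v).1 x = ∑ i, N.act (coord k i (x : UP k 5)) (v i) := rfl

theorem mem_homJDeg (N : GrMod.{u, u, w} (degP k 5)) {n : ℕ} {φ : homJ N} :
    φ ∈ homJDeg N n ↔ ∀ i, evEquiv N φ i ∈ N.deg n := by
  constructor
  · intro h i
    exact h 0 (jgenJ k i) (UE_mem_degP k _ _)
  · intro h m x hx
    obtain ⟨v, rfl⟩ := (evEquiv N).symm.surjective φ
    rw [LinearEquiv.apply_symm_apply] at h
    rw [evEquiv_symm_apply]
    refine sum_mem fun i _ => ?_
    rw [add_comm]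
    exact N.act_mem (coord_deg k hx i) (h i)

theorem isInternal_of_pi {k : Type u} [CommRing k] {M : Type v} {N : Type w} [AddCommGroup M]
    [Module k M] [AddCommGroup N] [Module k N] {ι : Type} [Fintype ι] [DecidableEq ι]
    (e : M ≃ₗ[k] (ι → N)) {D : ℕ → Submodule k M} {S : ℕ → Submodule k N}
    (hS : DirectSum.IsInternal S) (hD : ∀ n φ, φ ∈ D n ↔ ∀ i, e φ i ∈ S n) :
    DirectSum.IsInternal D := by
  refine DirectSum.isInternal_submodule_of_iSupIndep_of_iSup_eq_top ?_ ?_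
  · apply iSupIndep_of_dfinsupp_lsum_injective
    refine LinearMap.ker_eq_bot.1 (LinearMap.ker_eq_bot'.2 fun f hf => ?_)
    ext n : 1
    apply Subtype.ext
    apply e.injective
    funext i
    let T : (n : ℕ) → D n →ₗ[k] S n := fun n =>
      { toFun := fun φ => ⟨e φ.1 i, (hD n _).1 φ.2 i⟩
        map_add' := fun φ ψ => Subtype.ext (by simp)
        map_smul' := fun c φ => Subtype.ext (by simp) }
    have hT : (DFinsupp.lsum ℕ (fun n => (S n).subtype)) ∘ₗ (DFinsupp.mapRange.linearMap T) =
        (LinearMap.proj i ∘ₗ e.toLinearMap) ∘ₗ (DFinsupp.lsum ℕ fun n => (D n).subtype) := by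
      ext n φ
      simp [T]
    have h0 := DFunLike.congr_fun hT f
    simp only [LinearMap.comp_apply] at h0
    rw [hf, map_zero, map_zero] at h0
    have hinj : Function.Injective (DFinsupp.lsum ℕ (fun n => (S n).subtype)) := hS.injective
    have h1 := hinj (h0.trans (map_zero _).symm)
    have h2 := congrArg (fun g : Π₀ n, S n => (g n : N)) h1
    refine Eq.trans h2 ?_
    simp
  · rw [eq_top_iff]
    have hs : ∀ (i : ι) (m : N), e.symm (Pi.single i m) ∈ ⨆ n, D n := by
      intro i m
      have hm : m ∈ ⨆ n, S n := by rw [hS.submodule_iSup_eq_top]; trivial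
      induction hm using Submodule.iSup_induction' with
      | mem n x hx =>
        refine Submodule.mem_iSup_of_mem n ((hD n _).2 fun j => ?_)
        rw [LinearEquiv.apply_symm_apply]
        by_cases h : j = i
        · subst h; rw [Pi.single_eq_same]; exact hx
        · rw [Pi.single_eq_of_ne h]; exact zero_mem _
      | zero => rw [Pi.single_zero, map_zero]; exact zero_mem _
      | add x y _ _ hx hy => rw [Pi.single_add, map_add]; exact add_mem hx hy
    intro φ _
    have h : φ = ∑ i, e.symm (Pi.single i (e φ i)) := by
      rw [← map_sum, Finset.univ_sum_single, LinearEquiv.symm_apply_apply]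
    rw [h]
    exact sum_mem fun i _ => hs i _

theorem homJ_isInternal (N : GrMod.{u, u, w} (degP k 5)) : DirectSum.IsInternal (homJDeg N) :=
  isInternal_of_pi (evEquiv N) N.isInternal fun _ _ => mem_homJDeg N

variable (k)

/-- The endofunctor `N ↦ Hom_{U(𝔭₅)}(J(pr_5), N)` of graded `U(𝔭₅)`-modules. -/
def FJ : GrMod.{u, u, max u w} (degP k 5) ⥤ GrMod.{u, u, max u w} (degP k 5) where
  obj N :=
    { carrier := homJ N
      act := homJAct N
      deg := homJDeg N
      isInternal := homJ_isInternal N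
      act_mem := fun {i j b φ} hb hφ m x hx => by
        have h := hφ (m + i) (rightMulJ k b x) (by
          have := mul_mem_degP k hx hb
          rwa [show m + 1 + i = m + i + 1 by omega] at this)
        rw [show i + j + m = j + (m + i) by omega]
        exact h }
  map {N N'} f :=
    { toLin :=
        { toFun := fun φ => ⟨f.toLin ∘ₗ φ.1, fun a x => by
            rw [LinearMap.comp_apply, φ.2 a x, f.map_act]; rfl⟩
          map_add' := fun φ ψ => by ext x; exact map_add f.toLin _ _
          map_smul' := fun c φ => by ext x; exact map_smul f.toLin _ _ }
      map_act := fun a φ => rfl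
      map_deg := fun h m x hx => f.map_deg (h m x hx) }

end HomJ

/-- `V(C) = ℓ^* ∘ F_{J(pr_5)} ∘ pr_12^* (C)`, as a functor. -/
def VFunctor : GrMod.{u, u, max u w} (degFF k) ⥤ GrMod.{u, u, max u w} (degF2 k) :=
  GrMod.pullback (Upr12 k) (Upr12_deg k) ⋙ FJ.{u, w} k ⋙ GrMod.pullback (Uell k) (Uell_deg k)

theorem base_deg (n : ℕ) (a : k) (ha : a ∈ baseDeg k n) :
    Algebra.ofId k (UF2 k ⊗[k] UF2 k) a ∈ degFF k n := by
  rw [baseDeg] at ha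
  split_ifs at ha with h
  · subst h
    rw [Algebra.ofId_apply, Algebra.algebraMap_eq_smul_one]
    exact Submodule.smul_mem _ a (one_mem_degFF k)
  · rw [Submodule.mem_bot] at ha
    rw [ha, map_zero]; exact zero_mem _

/-- `W(C)`: the module `C` viewed as a graded `k`-module, as a functor. -/
def WFunctor : GrMod.{u, u, w} (degFF k) ⥤ GrMod.{u, u, w} (baseDeg k) :=
  GrMod.pullback (Algebra.ofId k (UF2 k ⊗[k] UF2 k)) (base_deg k)

section AlphaBeta

variable {k}
variable (C : GrMod.{u, u, max u w} (degFF k))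

/-- The graded `U(𝔭₅)`-module `pr_12^* C`. -/
abbrev pr12Pull : GrMod.{u, u, max u w} (degP k 5) :=
  GrMod.pullObj (Upr12 k) (Upr12_deg k) C

/-- The evaluation `φ ↦ φ(e_{i+1,5})` on `V(C) = Hom_{U(𝔭₅)}(J(pr_5), pr_12^* C)`. -/
def evC (i : Fin 3) : homJ (pr12Pull.{u, w} C) →ₗ[k] C.carrier where
  toFun φ := φ.1 (jgenJ k i)
  map_add' _ _ := rfl
  map_smul' _ _ := rfl

/-- `α(C) : φ ↦ e_1 φ(e_15) - f_1 φ(e_25)` with `e_1 = e_1 ⊗ 1`, `f_1 = 1 ⊗ e_1`. -/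
def alphaC : homJ (pr12Pull.{u, w} C) →ₗ[k] C.carrier :=
  C.act (e1 k ⊗ₜ[k] 1) ∘ₗ evC C 0 - C.act (1 ⊗ₜ[k] e1 k) ∘ₗ evC C 1

/-- The map `c ↦ (c, -c, 0)`. -/
def colC : C.carrier →ₗ[k] (Fin 3 → C.carrier) := LinearMap.pi ![LinearMap.id, -LinearMap.id, 0]

/-- `β(C) : c ↦ φ_c`, where `φ_c(e_15) = c`, `φ_c(e_25) = -c`, `φ_c(e_35) = 0`. -/
def betaC : C.carrier →ₗ[k] homJ (pr12Pull.{u, w} C) :=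
  (evEquiv (pr12Pull.{u, w} C)).symm.toLinearMap ∘ₗ colC C

theorem evC_betaC (c : C.carrier) (i : Fin 3) : evC C i (betaC C c) = colC C c i :=
  congrFun ((evEquiv (pr12Pull.{u, w} C)).apply_symm_apply (colC C c)) i

theorem homJ_ext {φ ψ : homJ (pr12Pull.{u, w} C)} (h : ∀ i, evC C i φ = evC C i ψ) : φ = ψ :=
  (evEquiv (pr12Pull.{u, w} C)).injective (funext h)

theorem mem_homJDeg_iff {n : ℕ} {φ : homJ (pr12Pull.{u, w} C)} :
    φ ∈ homJDeg (pr12Pull.{u, w} C) n ↔ ∀ i, evC C i φ ∈ C.deg n :=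
  mem_homJDeg (pr12Pull.{u, w} C)

theorem alphaC_deg {n : ℕ} {φ : homJ (pr12Pull.{u, w} C)}
    (hφ : φ ∈ homJDeg (pr12Pull.{u, w} C) n) : alphaC C φ ∈ C.deg (n + 1) := by
  have h := (mem_homJDeg_iff C).1 hφ
  have h0 := C.act_mem (tmul_mem_tensorDeg (add_zero 1) e1_mem one_mem_degF2) (h 0)
  have h1 := C.act_mem (tmul_mem_tensorDeg (zero_add 1) one_mem_degF2 e1_mem) (h 1)
  rw [add_comm n 1]
  exact sub_mem h0 h1

theorem betaC_deg {n : ℕ} {c : C.carrier} (hc : c ∈ C.deg n) :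
    betaC C c ∈ homJDeg (pr12Pull.{u, w} C) n := by
  refine (mem_homJDeg_iff C).2 fun i => ?_
  rw [evC_betaC]
  fin_cases i
  · exact hc
  · exact neg_mem hc
  · exact zero_mem (C.deg n)

theorem homJ_apply (φ : homJ (pr12Pull.{u, w} C)) (x : J k) :
    φ.1 x = ∑ i, C.act (Upr12 k (coord k i (x : UP k 5))) (evC C i φ) := by
  conv_lhs => rw [← (evEquiv (pr12Pull.{u, w} C)).symm_apply_apply φ]
  rfl

theorem coord_jgen_mul (i j : Fin 3) : coord k j (jgen k i * UE k 0 1) =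
    matA (UE k 0 1) (UE k 0 4) (UE k 1 4) i.succ j.succ := by
  change Psi k (jgen k i * UE k 0 1) 0 j.succ = _
  rw [map_mul, Matrix.mul_apply, Psi_a]
  simp only [Psi_jgen]
  simp [colHat]

theorem colC_sub (c d v w : C.carrier) (hc : C.act (e1 k ⊗ₜ[k] 1) v = c)
    (hd : C.act (1 ⊗ₜ[k] e1 k) w = d) (z : C.carrier) (i : Fin 3) :
    colC C (c - d) i =
      C.act (Upr12 k (matA (UE k 0 1) (UE k 0 4) (UE k 1 4) i.succ 1)) v +
      C.act (Upr12 k (matA (UE k 0 1) (UE k 0 4) (UE k 1 4) i.succ 2)) w +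
      C.act (Upr12 k (matA (UE k 0 1) (UE k 0 4) (UE k 1 4) i.succ 3)) z := by
  subst hc hd
  fin_cases i
  · simp [matA, colC, Upr12_a, Upr12_x, Upr12_y, sub_eq_add_neg]
  · simp [matA, colC, Upr12_a, Upr12_x, Upr12_y, sub_eq_add_neg, add_comm]
  · simp [matA, colC, Upr12_a, Upr12_x, Upr12_y, sub_eq_add_neg]

theorem evC_homJAct (a : UP k 5) (φ : homJ (pr12Pull.{u, w} C)) (i : Fin 3) :
    evC C i (homJAct (pr12Pull.{u, w} C) a φ) =
      φ.1 ⟨jgen k i * a, J_mul_right k _ (jgen_mem k i)⟩ := rfl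

theorem betaC_comp_alphaC :
    betaC C ∘ₗ alphaC C = homJAct (pr12Pull.{u, w} C) (Uell k (e1 k)) := by
  refine LinearMap.ext fun φ => homJ_ext C fun i => ?_
  rw [LinearMap.comp_apply, evC_betaC, Uell_e1, evC_homJAct, homJ_apply, Fin.sum_univ_three]
  simp only [coord_jgen_mul]
  exact colC_sub C _ _ _ _ rfl rfl _ i

end AlphaBeta

/-- The functor `F_VQ : GrMod(U(𝔣₂)^{⊗2}) ⥤ Quad`, `C ↦ (V(C), W(C), α(C), β(C))`. -/
def FVQ : GrMod.{u, u, max u w} (degFF k) ⥤ Quad.{u, max u w} k where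
  obj C :=
    { V := (VFunctor.{u, w} k).obj C
      W := (WFunctor k).obj C
      α := alphaC C
      β := betaC C
      α_deg := alphaC_deg C
      β_deg := betaC_deg C
      β_comp_α := betaC_comp_alphaC C }
  map {C C'} f :=
    { f := (VFunctor.{u, w} k).map f
      g := (WFunctor k).map f
      comm_α := fun (φ : homJ (pr12Pull.{u, w} C)) => by
        change f.toLin (C.act (e1 k ⊗ₜ[k] 1) (evC C 0 φ) - C.act (1 ⊗ₜ[k] e1 k) (evC C 1 φ)) =
          C'.act (e1 k ⊗ₜ[k] 1) (f.toLin (evC C 0 φ)) -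
            C'.act (1 ⊗ₜ[k] e1 k) (f.toLin (evC C 1 φ))
        rw [map_sub, f.map_act, f.map_act]
      comm_β := fun (c : C.carrier) => by
        refine homJ_ext C' fun i => ?_
        change f.toLin (evC C i (betaC C c)) = evC C' i (betaC C' (f.toLin c))
        rw [evC_betaC, evC_betaC]
        fin_cases i
        · rfl
        · exact map_neg f.toLin c
        · exact map_zero f.toLin }

theorem FVQ_isFin (C : GrMod.{u, u, max u w} (degFF k)) (hC : GrMod.IsFin (degFF k) C) :
    Quad.IsFin k ((FVQ.{u, w} k).obj C) := by
  refine ⟨Set.Finite.subset hC fun n hn h0 => hn ?_, hC⟩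
  refine (Submodule.eq_bot_iff _).2 fun (φ : homJ (pr12Pull.{u, w} C)) hφ => homJ_ext C fun i => ?_
  have h := (mem_homJDeg_iff C).1 hφ i
  rw [h0, Submodule.mem_bot] at h
  exact h.trans (map_zero (evC C i)).symm

/-- `(inc^{⊗2})^*`. -/
def incPull : GrMod.{u, u, w} (degFF k) ⥤ GrMod.{u, u, w} (degWW k) :=
  GrMod.pullback (incTensor k) (incTensor_deg k)

/-- `(Δ_⋆^{l,r})^*`. -/
def deltaPull : GrMod.{u, u, w} (degWW k) ⥤ GrMod.{u, u, w} (degWl k) :=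
  GrMod.pullback (deltaLR k) (deltaLR_deg k)

/-- `F_VQ` on finite support subcategories. -/
def FVQFin : GrModFin.{u, u, max u w} (degFF k) ⥤ QuadFin.{u, max u w} k :=
  restrict (FVQ.{u, w} k) _ _ (FVQ_isFin k)

/-- `F_QW` on finite support subcategories. -/
def FQWFin : QuadFin.{u, w} k ⥤ GrModFin.{u, u, w} (degWl k) :=
  restrict (FQW k) _ _ fun _ hQ => hQ.2

/-- `(inc^{⊗2})^*` on finite support subcategories. -/
def incPullFin : GrModFin.{u, u, w} (degFF k) ⥤ GrModFin.{u, u, w} (degWW k) :=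
  restrict (incPull k) _ _ fun _ hM => hM

/-- `(Δ_⋆^{l,r})^*` on finite support subcategories. -/
def deltaPullFin : GrModFin.{u, u, w} (degWW k) ⥤ GrModFin.{u, u, w} (degWl k) :=
  restrict (deltaPull k) _ _ fun _ hM => hM

end Functors

end DeRham

end

noncomputable section

namespace DeRham

section Comparison

/-! ### The coproduct side: images of the free generators in $U(\mathfrak f_2)^{\otimes 2}$. -/

variable {k : Type u} [CommRing k]

/-! For a graded module $C$ over $U(\mathfrak f_2)^{\otimes 2}$, both composite functors return the
space $C$ with its own grading, and both send a morphism to the same underlying linear map. Only the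
two actions of $\mathcal W_l^{\mathrm{DR}}$ have to be compared. Once they coincide
(`actW_FVQ_obj`), the identity of $C$ is the required isomorphism, and naturality is automatic.

Since $\mathcal W_l^{\mathrm{DR}}$ is free on the elements $y_{n+1} = -e_0^n e_1$, it suffices to
compare the actions of these. Write $e_i$ for $e_i \otimes 1$ and $f_i$ for $1 \otimes e_i$. On the
coproduct side, $\mathrm{Ad}(e_1)$ turns $y_{n+1}$ into $-e_1e_0^n$, and
`incTensor_deltaLR_kyEquivWl_Y` gives the operator $-(e_1e_0^n + f_1f_0^n - \sum_{i<n} e_1e_0^i\,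
f_1f_0^{n-1-i})$. On the quadruple side, $y_{n+1}$ acts as $-\alpha \circ e_0^n \circ \beta$, so the
powers of $e_0$ on $V(C)$ must be understood.

As $J(\mathrm{pr}_5)$ is free on $e_{15}, e_{25}, e_{35}$, an element $\varphi$ of $V(C)$ amounts to
the triple of its values there. The generator $e_0$ acts through $\ell$, that is by precomposition
with right multiplication by $e_{23}$, whose matrix in this basis is the lower right block of
`matB`. This matrix becomes triangular in the coordinates $\varphi(e_{15})$, $\varphi(e_{25})$,
$\varphi(e_{25}) + \varphi(e_{35})$: because $e_{23}$ commutes with $e_{15}$ and with $e_{25} +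
e_{35}$, the first and the third are simply multiplied by $e_0$, while the second becomes $f_0$
times itself minus $e_1$ times the third.

Starting from $\varphi_c$, whose coordinates are $(c, -c, -c)$, the recursion for the second
coordinate is solved by the geometric-type sum $\sum_{i<m} e_1e_0^i f_0^{m-1-i} c - f_0^m c$
(`evC_homJAct_e0_pow_betaC`). Applying $\alpha = e_1\varphi(e_{15}) - f_1\varphi(e_{25})$ turns this
sum into the quadratic part of the coproduct formula (`alphaC_homJAct_e0_pow_betaC`). -/

theorem incTensor_deltaLR_kyEquivWl_Y (n : ℕ) :
    incTensor k (deltaLR k (kyEquivWl k (Y k n))) =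
      -((e1 k * e0 k ^ n) ⊗ₜ[k] 1 + 1 ⊗ₜ[k] (e1 k * e0 k ^ n) -
        ∑ i ∈ Finset.range n, (e1 k * e0 k ^ i) ⊗ₜ[k] (e1 k * e0 k ^ (n - 1 - i))) := by
  -- The symbol of index `i` stands for $y_{i+1} = x_0^i x_1$; the sign comes from $x_1 = -e_1$, and
  -- $\mathrm{Ad}(e_1)$ moves the final $e_1$ to the front.
  have hA : ∀ i, ((AdE1 (kyEquivWl k (Y k i)) : Wr k) : UF2 k) = -(e1 k * e0 k ^ i) := by
    intro i
    have h : kyEquivWl k (Y k i) = WlY k i := FreeAlgebra.lift_ι_apply _ _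
    rw [h, WlY, AdE1_WlMk]
    exact mul_neg _ _
  -- `deltaStar` is `deltaKY` transported along `kyEquivWl`, so on an element coming from $\mathbf
  -- k\langle Y\rangle$ the inverse isomorphism cancels.
  have hd : deltaStar k (kyEquivWl k (Y k n)) =
      Algebra.TensorProduct.map (kyEquivWl k).toAlgHom (kyEquivWl k).toAlgHom
        (deltaKY k (Y k n)) := by
    change Algebra.TensorProduct.map (kyEquivWl k).toAlgHom (kyEquivWl k).toAlgHom
      (deltaKY k ((kyEquivWl k).symm (kyEquivWl k (Y k n)))) = _
    rw [AlgEquiv.symm_apply_apply]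
  have hY : deltaKY k (Y k n) = Y k n ⊗ₜ[k] 1 + 1 ⊗ₜ[k] Y k n +
      ∑ j ∈ Finset.range n, Y k j ⊗ₜ[k] Y k (n - 1 - j) := FreeAlgebra.lift_ι_apply _ _
  rw [deltaLR, AlgHom.comp_apply, hd, hY]
  have hA' : ∀ i, (Wr k).val (AdE1 ((kyEquivWl k).toAlgHom (Y k i))) = -(e1 k * e0 k ^ i) := hA
  -- Each linear term keeps its sign, whereas the two signs in $y_{n'} \otimes y_{n''}$ cancel. This
  -- is why the sum enters with the opposite sign once $-1$ is factored out.
  simp only [incTensor, map_add, map_sum, Algebra.TensorProduct.map_tmul, map_one, hA',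
    TensorProduct.neg_tmul, TensorProduct.tmul_neg, neg_neg]
  abel

/-! ### The quadruple side: powers of $e_0$ on $V(C)$ and the operators $\alpha \circ e_0^m \circ
\beta$. -/

variable [Algebra ℚ k]

/-- Coordinates are read off the top row of `Psi`, which is multiplicative. The top row of `Psi` at
a basis element of $J(\mathrm{pr}_5)$ is a unit vector, because the top entry of `colHat` is $1$;
multiplying by `Psi k (UE k 1 2)` therefore selects one of its rows. This is the matrix of right
multiplication by $e_{23}$ on the free left module $J(\mathrm{pr}_5)$. -/
theorem coord_jgen_mul_UE_one_two (i j : Fin 3) : coord k j (jgen k i * UE k 1 2) =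
    matB (UE k 1 2) (UE k 1 4) (UE k 2 4) i.succ j.succ := by
  change Psi k (jgen k i * UE k 1 2) 0 j.succ = _
  rw [map_mul, Matrix.mul_apply, Psi_b]
  simp only [Psi_jgen]
  simp [colHat]

section Action

variable (C : GrMod.{u, u, max u w} (degFF k)) (φ : homJ (pr12Pull.{u, w} C))

/-- The action is precomposition with right multiplication, so the left side is $\varphi$ at a basis
element times $e_{23}$. Expanding this product in the basis and using the $U(\mathfrak
p_5)$-linearity of $\varphi$ gives a matrix acting on the triple of values, with entries pushed to
$U(\mathfrak f_2)^{\otimes 2}$ by $\mathrm{pr}_{12}$. -/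
theorem evC_homJAct_UE_one_two (i : Fin 3) :
    evC C i (homJAct (pr12Pull.{u, w} C) (UE k 1 2) φ) =
      ∑ j : Fin 3, C.act (Upr12 k (matB (UE k 1 2) (UE k 1 4) (UE k 2 4) i.succ j.succ))
        (evC C j φ) := by
  rw [evC_homJAct, homJ_apply]
  simp only [coord_jgen_mul_UE_one_two]

/-- Reflects $e_{15}e_{23} = e_{23}e_{15}$ together with $\mathrm{pr}_{12}(e_{23}) = e_0 \otimes 1$:
the first basis vector does not mix with the other two. -/
theorem evC_zero_homJAct_e0 :
    evC C 0 (homJAct (pr12Pull.{u, w} C) (Uell k (e0 k)) φ) =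
      C.act (e0 k ⊗ₜ[k] 1) (evC C 0 φ) := by
  rw [Uell_e0, evC_homJAct_UE_one_two]
  simp [Fin.sum_univ_three, matB, Upr12_b]

/-- The relevant row of `matB` has the entries $e_{23} + e_{35}$ and $-e_{25}$. Under
$\mathrm{pr}_{12}$ the terms $e_0 \otimes 1$ cancel in the first, which becomes $1 \otimes e_0 - e_1
\otimes 1$, and the second becomes $-e_1 \otimes 1$. The two occurrences of $e_1 \otimes 1$ are
grouped so that only the sum of the values at $e_{25}$ and $e_{35}$ appears beside the diagonal
term. -/
theorem evC_one_homJAct_e0 :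
    evC C 1 (homJAct (pr12Pull.{u, w} C) (Uell k (e0 k)) φ) =
      C.act (1 ⊗ₜ[k] e0 k) (evC C 1 φ) -
        C.act (e1 k ⊗ₜ[k] 1) (evC C 1 φ + evC C 2 φ) := by
  rw [Uell_e0, evC_homJAct_UE_one_two]
  simp [Fin.sum_univ_three, matB, Upr12_b, Upr12_y, Upr12_z, TensorProduct.sub_tmul,
    TensorProduct.neg_tmul]
  abel

/-- The element $e_{25} + e_{35}$ commutes with $e_{23}$: adding the last two rows of `matB` leaves
$e_{23}$ in each of the last two columns. Thus this sum evolves independently of the other values,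
which makes the action of $e_0$ triangular. -/
theorem evC_one_add_two_homJAct_e0 :
    evC C 1 (homJAct (pr12Pull.{u, w} C) (Uell k (e0 k)) φ) +
        evC C 2 (homJAct (pr12Pull.{u, w} C) (Uell k (e0 k)) φ) =
      C.act (e0 k ⊗ₜ[k] 1) (evC C 1 φ + evC C 2 φ) := by
  rw [Uell_e0, evC_homJAct_UE_one_two, evC_homJAct_UE_one_two]
  simp [Fin.sum_univ_three, matB, Upr12_b, Upr12_y, Upr12_z, TensorProduct.sub_tmul,
    TensorProduct.neg_tmul]
  abel

/-- The values at `e_15` and `e_25`, and the sum of the values at `e_25` and `e_35`, of the map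
`e_0^m φ_c`. -/
theorem evC_homJAct_e0_pow_betaC (m : ℕ) (c : C.carrier) :
    evC C 0 (homJAct (pr12Pull.{u, w} C) (Uell k (e0 k ^ m)) (betaC C c)) =
        C.act ((e0 k ^ m) ⊗ₜ[k] 1) c ∧
      evC C 1 (homJAct (pr12Pull.{u, w} C) (Uell k (e0 k ^ m)) (betaC C c)) =
        C.act (∑ i ∈ Finset.range m, (e1 k * e0 k ^ i) ⊗ₜ[k] (e0 k ^ (m - 1 - i)) -
          1 ⊗ₜ[k] (e0 k ^ m)) c ∧
      evC C 1 (homJAct (pr12Pull.{u, w} C) (Uell k (e0 k ^ m)) (betaC C c)) +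
          evC C 2 (homJAct (pr12Pull.{u, w} C) (Uell k (e0 k ^ m)) (betaC C c)) =
        -C.act ((e0 k ^ m) ⊗ₜ[k] 1) c := by
  -- The clause about the sum is needed for the induction: the recursion for the value at $e_{25}$
  -- involves the value at $e_{35}$ only through that sum, which has a recursion of its own.
  induction m with
  | zero =>
    have h : (1 : UF2 k) ⊗ₜ[k] (1 : UF2 k) = 1 := rfl
    simp only [pow_zero, map_one, Module.End.one_apply, Finset.range_zero, Finset.sum_empty,
      zero_sub, map_neg, h, LinearMap.neg_apply]
    -- At exponent $0$ the values are those of $\varphi_c$, namely $(c, -c, 0)$, and the last two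
    -- add up to $-c$.
    refine ⟨evC_betaC C c 0, evC_betaC C c 1, ?_⟩
    exact (congrArg₂ (· + ·) (evC_betaC C c 1) (evC_betaC C c 2)).trans (add_zero (-c))
  | succ m ih =>
    obtain ⟨h₀, h₁, h₂⟩ := ih
    -- The new factor is split off on the left, so that the one-step formulas apply to
    -- $e_0^m\varphi_c$, whose values are known.
    have hs : Uell k (e0 k ^ (m + 1)) = Uell k (e0 k) * Uell k (e0 k ^ m) := by
      rw [pow_succ', map_mul]
    rw [hs, map_mul, Module.End.mul_apply]
    refine ⟨?_, ?_, ?_⟩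
    · rw [evC_zero_homJAct_e0, h₀, ← Module.End.mul_apply, ← map_mul,
        Algebra.TensorProduct.tmul_mul_tmul, ← pow_succ', mul_one]
    -- Multiplying by $1 \otimes e_0$ raises the second exponent by one and so produces the terms $i
    -- < m$ of the next sum. The bound on $i$ is essential here because the subtraction of natural
    -- numbers is truncated.
    · have hsum : ∀ i ∈ Finset.range m, (e1 k * e0 k ^ i) ⊗ₜ[k] (e0 k ^ (m + 1 - 1 - i)) =
          (1 ⊗ₜ[k] e0 k) * ((e1 k * e0 k ^ i) ⊗ₜ[k] (e0 k ^ (m - 1 - i))) := by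
        intro i hi
        have := Finset.mem_range.1 hi
        rw [Algebra.TensorProduct.tmul_mul_tmul, one_mul, ← pow_succ',
          show m + 1 - 1 - i = m - 1 - i + 1 by omega]
      -- By the third clause, the correction $-(e_1 \otimes 1)$ applied to the sum of the two values
      -- is $+(e_1e_0^m \otimes 1)c$. It is the new last term $i = m$, whose second exponent is $0$.
      rw [evC_one_homJAct_e0, h₂, h₁, map_neg, sub_neg_eq_add, ← Module.End.mul_apply,
        ← Module.End.mul_apply, ← map_mul, ← map_mul, ← LinearMap.add_apply, ← map_add,
        Finset.sum_range_succ, Finset.sum_congr rfl hsum, ← Finset.mul_sum, mul_sub,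
        Algebra.TensorProduct.tmul_mul_tmul, Algebra.TensorProduct.tmul_mul_tmul, ← pow_succ',
        mul_one, show m + 1 - 1 - m = 0 by omega, pow_zero]
      congr 2
      abel
    · rw [evC_one_add_two_homJAct_e0, h₂, map_neg, ← Module.End.mul_apply, ← map_mul,
        Algebra.TensorProduct.tmul_mul_tmul, ← pow_succ', mul_one]

/-- The endomorphism `α(C) ∘ e_0^m ∘ β(C)`. -/
theorem alphaC_homJAct_e0_pow_betaC (m : ℕ) (c : C.carrier) :
    alphaC C (homJAct (pr12Pull.{u, w} C) (Uell k (e0 k ^ m)) (betaC C c)) =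
      C.act ((e1 k * e0 k ^ m) ⊗ₜ[k] 1 + 1 ⊗ₜ[k] (e1 k * e0 k ^ m) -
        ∑ i ∈ Finset.range m, (e1 k * e0 k ^ i) ⊗ₜ[k] (e1 k * e0 k ^ (m - 1 - i))) c := by
  obtain ⟨h₀, h₁, -⟩ := evC_homJAct_e0_pow_betaC C m c
  change C.act (e1 k ⊗ₜ[k] 1) (evC C 0 _) - C.act (1 ⊗ₜ[k] e1 k) (evC C 1 _) = _
  rw [h₀, h₁, ← Module.End.mul_apply, ← Module.End.mul_apply, ← map_mul, ← map_mul,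
    ← LinearMap.sub_apply, ← map_sub, mul_sub, Finset.mul_sum]
  -- Left multiplication by $1 \otimes e_1$ puts the missing $e_1$ in front of each second factor.
  -- The minus sign in $\alpha$ makes $-(1 \otimes e_0^m)$ contribute $+(1 \otimes e_1e_0^m)$ and
  -- makes the sum negative.
  simp only [Algebra.TensorProduct.tmul_mul_tmul, one_mul, mul_one]
  congr 2
  abel

end Action

/-! ### Equality of the two actions, and the natural equivalences. -/

/-- On the space `C`, the action of `𝒲_l` through `Δ_⋆^{l,r}` is its action on `W(C)`. -/
theorem actW_FVQ_obj (C : GrMod.{u, u, max u w} (degFF k)) (a : Wl k) :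
    ((FVQ.{u, w} k).obj C).actW a = C.act (incTensor k (deltaLR k a)) := by
  -- Both actions are algebra morphisms, so after composition with `kyEquivWl` they become morphisms
  -- out of a free algebra, and only the generators need to be compared.
  have h : (((FVQ.{u, w} k).obj C).actW).comp (kyEquivWl k).toAlgHom =
      ((C.act.comp (incTensor k)).comp (deltaLR k)).comp (kyEquivWl k).toAlgHom := by
    apply FreeAlgebra.hom_ext
    funext n
    change ((FVQ.{u, w} k).obj C).actW (kyEquivWl k (Y k n)) =
      C.act (incTensor k (deltaLR k (kyEquivWl k (Y k n))))
    have hY : kyEquivWl k (Y k n) = WlY k n := FreeAlgebra.lift_ι_apply _ _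
    rw [incTensor_deltaLR_kyEquivWl_Y, hY, WlY, Quad.actW_WlMk]
    refine LinearMap.ext fun (c : C.carrier) => ?_
    -- Since $y_{n+1} = (-e_0^n)e_1$, it acts on $W(C)$ as $\alpha \circ (-e_0^n) \circ \beta$, and
    -- $U(\mathfrak f_2)$ acts on $V(C)$ through $\ell$. The sign then passes through every map by
    -- linearity and matches the one on the coproduct side.
    change alphaC C (homJAct (pr12Pull.{u, w} C) (Uell k (-e0 k ^ n)) (betaC C c)) = _
    rw [map_neg, map_neg, LinearMap.neg_apply, map_neg, alphaC_homJAct_e0_pow_betaC, map_neg]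
    rfl
  obtain ⟨p, rfl⟩ := (kyEquivWl k).surjective a
  exact DFunLike.congr_fun h p

/-- The isomorphism of graded modules given by a bijective `A`-linear map compatible with the
gradings. -/
def GrMod.isoOfLinearEquiv {A : Type v} [Ring A] [Algebra k A] {𝒜 : ℕ → Submodule k A}
    {M N : GrMod.{u, v, w} 𝒜} (e : M.carrier ≃ₗ[k] N.carrier)
    (hact : ∀ a m, e (M.act a m) = N.act a (e m)) (hdeg : ∀ n m, m ∈ M.deg n ↔ e m ∈ N.deg n) :
    M ≅ N where
  hom := ⟨e.toLinearMap, hact, fun h => (hdeg _ _).1 h⟩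
  -- Linearity of the inverse over $A$ is checked after applying `e`. Preservation of degrees by the
  -- inverse is where the converse implication in `hdeg` is needed.
  inv := ⟨e.symm.toLinearMap, fun a m => e.injective (by simp [hact]),
    fun h => (hdeg _ _).2 (by simpa using h)⟩
  hom_inv_id := GrMod.Hom.ext (LinearMap.ext e.symm_apply_apply)
  inv_hom_id := GrMod.Hom.ext (LinearMap.ext e.apply_symm_apply)

variable (k)

/-- The natural equivalence `η^DR`, whose component at `C` is the identity of the space `C`. -/
def eta : incPull.{u, max u w} k ⋙ deltaPull.{u, max u w} k ≅
    FVQ.{u, w} k ⋙ FQW.{u, max u w} k :=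
  NatIso.ofComponents
    -- The carriers and gradings of the two images of $C$ agree definitionally, so the identity map
    -- typechecks and the degree condition is trivial; the equality of actions is the only content.
    (fun C => GrMod.isoOfLinearEquiv (LinearEquiv.refl k C.carrier)
      (fun a m => (DFunLike.congr_fun (actW_FVQ_obj C a) m).symm) (fun _ _ => Iff.rfl))
    (fun _ => rfl)

/-- The restriction of `η^DR` to the modules with finite support. -/
def etaFin : incPullFin.{u, max u w} k ⋙ deltaPullFin.{u, max u w} k ≅
    FVQFin.{u, w} k ⋙ FQWFin.{u, max u w} k :=
  NatIso.ofComponents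
    -- The finite-support categories are full subcategories and the functors between them are
    -- restrictions, so each component of `eta` lifts as it is, and naturality is inherited.
    (fun C => ObjectProperty.isoMk _ ((eta.{u, w} k).app C.obj))
    (fun f => ObjectProperty.hom_ext _ ((eta.{u, w} k).hom.naturality f.hom))

end Comparison

end DeRham

end

/-- The last clause expresses that the second equivalence is the restriction of the first, and not
merely some equivalence between the restricted functors. It holds by definition, the components of
`etaFin` being those of `eta`. -/
theorem mainTheorem12 (k : Type u) [CommRing k] [Algebra ℚ k] :
    ∃ (η : DeRham.incPull.{u, max u w} k ⋙ DeRham.deltaPull.{u, max u w} k ≅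
          DeRham.FVQ.{u, w} k ⋙ DeRham.FQW.{u, max u w} k)
      (ηfin : DeRham.incPullFin.{u, max u w} k ⋙ DeRham.deltaPullFin.{u, max u w} k ≅
          DeRham.FVQFin.{u, w} k ⋙ DeRham.FQWFin.{u, max u w} k),
      ∀ C : DeRham.GrModFin.{u, u, max u w} (DeRham.degFF k),
        (ηfin.hom.app C).hom = η.hom.app C.obj := by
  exact ⟨DeRham.eta.{u, w} k, DeRham.etaFin.{u, w} k, fun _ => rfl⟩
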